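/- All matroids are finite. The Tutte polynomial of a matroid $M$ with ground set $E$ and rank function $r$ is $$T_M(x,y)=\sum_{A\subseteq E}(x-1)^{r(E)-r(A)}(y-1)^{|A|-r(A)}\in\mathbb{Z}[x,y].$$ A matroid is *graphic* if it is isomorphic to the cycle matroid of a multigraph (loops and parallel edges allowed), and it is a *Schubert* (or *nested*) matroid if its cyclic flats, i.e. the flats that are unions of circuits, form a chain under inclusion. For $0\le a\le b$ let $\mathsf{T}_{a,b}$ be the matroid on $\{1,\dots,b\}$ whose bases are the $a$-element subsets $B$ with $|B\cap\{1,\dots,a\}|\ge a-1$; it is the cycle matroid of a cycle of length $a+1$ in which one edge is replaced by $b-a$ parallel copies (so $\mathsf{T}_{0,b}=\mathsf{U}_{0,b}$ and $\mathsf{T}_{a,a}=\mathsf{U}_{a,a}$), and is called a *minimal matroid*. **Theorem.** Let $M$ be a matroid of rank $k$ on $n$ elements. 1. The Tutte polynomial of $M$ can be written uniquely as an integer combination of Tutte polynomials of graphic Schubert matroids of rank $k$ and size $n$; that is, there is exactly one family of integers $(c_N)$, indexed by the isomorphism classes of graphic Schubert matroids $N$ of rank $k$ on $n$ elements, with only finitely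 many $c_N\neq 0$, such that $T_M(x,y)=\sum_N c_N\,T_N(x,y)$. 2. $M$ is a graphic Schubert matroid if and only if it is a minimal matroid with added loops and coloops, that is, if and only if there are integers $m,\ell\ge 0$ with $\ell\le k$ and $m\le n-k$ such that $M$ is isomorphic to $\mathsf{U}_{0,m}\oplus\mathsf{T}_{k-\ell,\,n-\ell-m}\oplus\mathsf{U}_{\ell,\ell}$. -/

import Mathlib

/-- The set `C` of edges is the edge set of a cycle of the multigraph `G`: the cycle runs through
distinct vertices `v 0, …, v r` and distinct edges `e 0, …, e r`, where `e i` joins `v i` to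
`v (i + 1)` with indices modulo `r + 1`. For `r = 0` this is a loop edge, and for `r = 1` it is a
pair of parallel edges. -/
def Graph.IsCycleEdgeSet {V α : Type*} (G : Graph V α) (C : Set α) : Prop :=
  ∃ (r : ℕ) (v : Fin (r + 1) → V) (e : Fin (r + 1) → α),
    Function.Injective v ∧ Function.Injective e ∧
      (∀ i, G.IsLink (e i) (v i) (v (i + 1))) ∧ C = Set.range e

namespace Matroid

/-- Isomorphism of matroids: a bijection between the ground sets which preserves independence in
both directions. -/
def IsIso {α β : Type*} (M : Matroid α) (N : Matroid β) : Prop :=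
  ∃ e : M.E ≃ N.E, ∀ I : Set M.E,
    M.Indep (Subtype.val '' I) ↔ N.Indep (Subtype.val '' (e '' I))

/-- `M` is graphic: it is the cycle matroid of a multigraph, that is, its ground set is the edge set
of the graph and its circuits are the edge sets of the cycles. (Transporting edge labels along a
bijection, this is the same as being isomorphic to the cycle matroid of a multigraph.) -/
def IsGraphic {α : Type*} (M : Matroid α) : Prop :=
  ∃ (V : Type) (G : Graph V α), G.edgeSet = M.E ∧ ∀ C : Set α, M.IsCircuit C ↔ G.IsCycleEdgeSet C

/-- A cyclic flat is a flat which is a union of circuits. -/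
def IsCyclicFlat {α : Type*} (M : Matroid α) (F : Set α) : Prop :=
  M.IsFlat F ∧ ∀ e ∈ F, ∃ C ⊆ F, M.IsCircuit C ∧ e ∈ C

/-- `M` is a Schubert (or nested) matroid: its cyclic flats form a chain under inclusion. -/
def IsSchubert {α : Type*} (M : Matroid α) : Prop :=
  IsChain (· ⊆ ·) {F : Set α | M.IsCyclicFlat F}

/-- The Tutte polynomial of a finite matroid, with `x = X 0` and `y = X 1`:
the sum over all `A ⊆ E` of `(x - 1) ^ (r(E) - r(A)) * (y - 1) ^ (|A| - r(A))`. -/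
noncomputable def tutte {α : Type*} (M : Matroid α) [M.Finite] : MvPolynomial (Fin 2) ℤ :=
  ∑ A ∈ M.ground_finite.toFinset.powerset,
    (MvPolynomial.X 0 - 1) ^ (M.eRank.toNat - (M.eRk (A : Set α)).toNat) *
      (MvPolynomial.X 1 - 1) ^ (A.card - (M.eRk (A : Set α)).toNat)

theorem IsIso.refl {α : Type*} (M : Matroid α) : M.IsIso M :=
  ⟨Equiv.refl _, fun I => by simp⟩

theorem IsIso.symm {α β : Type*} {M : Matroid α} {N : Matroid β} (h : M.IsIso N) : N.IsIso M := by
  obtain ⟨e, he⟩ := h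
  refine ⟨e.symm, fun I => ?_⟩
  rw [he (e.symm '' I), Equiv.image_symm_image]

theorem IsIso.trans {α β γ : Type*} {M : Matroid α} {N : Matroid β} {P : Matroid γ}
    (h : M.IsIso N) (h' : N.IsIso P) : M.IsIso P := by
  obtain ⟨e, he⟩ := h
  obtain ⟨f, hf⟩ := h'
  refine ⟨e.trans f, fun I => ?_⟩
  rw [he, hf, Equiv.coe_trans, Set.image_comp]

theorem eRk_le_of_equiv {α β : Type*} {M : Matroid α} {N : Matroid β} (e : M.E ≃ N.E)
    (he : ∀ I : Set M.E, M.Indep (Subtype.val '' I) ↔ N.Indep (Subtype.val '' (e '' I)))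
    (A : Set M.E) : M.eRk (Subtype.val '' A) ≤ N.eRk (Subtype.val '' (e '' A)) := by
  obtain ⟨I, hIA, hI, hcard⟩ := le_eRk_iff.1 (le_refl (M.eRk (Subtype.val '' A)))
  obtain ⟨J, hJA, rfl⟩ := Set.subset_image_iff.1 hIA
  refine le_eRk_iff.2 ⟨Subtype.val '' (e '' J), Set.image_mono (Set.image_mono hJA),
    (he J).1 hI, ?_⟩
  rw [← hcard, Subtype.val_injective.encard_image, e.injective.encard_image,
    Subtype.val_injective.encard_image]

theorem eRk_eq_of_equiv {α β : Type*} {M : Matroid α} {N : Matroid β} (e : M.E ≃ N.E)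
    (he : ∀ I : Set M.E, M.Indep (Subtype.val '' I) ↔ N.Indep (Subtype.val '' (e '' I)))
    (A : Set M.E) : N.eRk (Subtype.val '' (e '' A)) = M.eRk (Subtype.val '' A) := by
  refine le_antisymm ?_ (eRk_le_of_equiv e he A)
  have h := eRk_le_of_equiv e.symm
    (fun I => by rw [he (e.symm '' I), Equiv.image_symm_image]) (e '' A)
  rwa [Equiv.symm_image_image] at h

open Classical in
/-- The Tutte polynomial is an isomorphism invariant. -/
theorem IsIso.tutte_eq {α β : Type*} {M : Matroid α} {N : Matroid β} [M.Finite] [N.Finite]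
    (h : M.IsIso N) : M.tutte = N.tutte := by
  obtain ⟨e, he⟩ := h
  have hrank : N.eRank = M.eRank := by
    have h := eRk_eq_of_equiv e he Set.univ
    simpa using h
  let i : Finset α → Finset β := fun A =>
    (A.subtype (· ∈ M.E)).map (e.toEmbedding.trans (Function.Embedding.subtype _))
  let j : Finset β → Finset α := fun B =>
    (B.subtype (· ∈ N.E)).map (e.symm.toEmbedding.trans (Function.Embedding.subtype _))
  unfold tutte
  refine Finset.sum_nbij' i j ?_ ?_ ?_ ?_ ?_
  · intro A _
    simp only [Finset.mem_powerset, i]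
    intro x hx
    simp only [Finset.mem_map, Function.Embedding.trans_apply] at hx
    obtain ⟨a, -, rfl⟩ := hx
    simp
  · intro B _
    simp only [Finset.mem_powerset, j]
    intro x hx
    simp only [Finset.mem_map, Function.Embedding.trans_apply] at hx
    obtain ⟨a, -, rfl⟩ := hx
    simp
  · intro A hA
    have hA' : ∀ x ∈ A, x ∈ M.E := fun x hx => by simpa using Finset.mem_powerset.1 hA hx
    ext x
    simp only [i, j, Finset.mem_map, Finset.mem_subtype, Function.Embedding.trans_apply,
      Equiv.coe_toEmbedding, Function.Embedding.subtype_apply]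
    constructor
    · rintro ⟨b, ⟨a, ha, hab⟩, rfl⟩
      have : b = e a := Subtype.ext hab.symm
      simpa [this] using ha
    · intro hx
      exact ⟨e ⟨x, hA' x hx⟩, ⟨⟨x, hA' x hx⟩, hx, rfl⟩, by simp⟩
  · intro B hB
    have hB' : ∀ x ∈ B, x ∈ N.E := fun x hx => by simpa using Finset.mem_powerset.1 hB hx
    ext x
    simp only [i, j, Finset.mem_map, Finset.mem_subtype, Function.Embedding.trans_apply,
      Equiv.coe_toEmbedding, Function.Embedding.subtype_apply]
    constructor
    · rintro ⟨b, ⟨a, ha, hab⟩, rfl⟩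
      have : b = e.symm a := Subtype.ext hab.symm
      simpa [this] using ha
    · intro hx
      exact ⟨e.symm ⟨x, hB' x hx⟩, ⟨⟨x, hB' x hx⟩, hx, rfl⟩, by simp⟩
  · intro A hA
    have hA' : ∀ x ∈ A, x ∈ M.E := fun x hx => by simpa using Finset.mem_powerset.1 hA hx
    have h1 : (Subtype.val '' {x : M.E | (x : α) ∈ A}) = (A : Set α) := by
      ext x
      simpa using hA' x
    have h2 : Subtype.val '' (e '' {x : M.E | (x : α) ∈ A}) = (i A : Set β) := by
      rw [← Set.image_comp]
      ext x
      simp [i]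
    have h3 := eRk_eq_of_equiv e he {x : M.E | (x : α) ∈ A}
    rw [h1, h2] at h3
    have h4 : (i A).card = A.card := by
      simp only [i, Finset.card_map, Finset.card_subtype]
      rw [Finset.filter_true_of_mem hA']
    rw [h3, h4, hrank]

/-- The graphic Schubert matroids of rank `k` on the ground set `Fin n`. -/
abbrev GraphicSchubert (n k : ℕ) : Type :=
  {N : Matroid (Fin n) // N.E = Set.univ ∧ N.eRank = k ∧ N.IsGraphic ∧ N.IsSchubert}

/-- Isomorphism, as an equivalence relation on graphic Schubert matroids of rank `k` on `Fin n`. -/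
def graphicSchubertSetoid (n k : ℕ) : Setoid (GraphicSchubert n k) where
  r N N' := N.1.IsIso N'.1
  iseqv := ⟨fun N => IsIso.refl N.1, IsIso.symm, IsIso.trans⟩

/-- The isomorphism classes of graphic Schubert matroids of size `n` and rank `k`. -/
def GraphicSchubertClass (n k : ℕ) : Type :=
  Quotient (graphicSchubertSetoid n k)

/-- The Tutte polynomial of an isomorphism class of graphic Schubert matroids. -/
noncomputable def GraphicSchubertClass.tutte {n k : ℕ} (q : GraphicSchubertClass n k) :
    MvPolynomial (Fin 2) ℤ :=
  Quotient.lift (s := graphicSchubertSetoid n k) (fun N => N.1.tutte)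
    (fun _ _ h => IsIso.tutte_eq h) q

/-- The minimal matroid `T_{k,n}` on `Fin n`, for `k ≤ n`: its bases are the `k`-subsets `B` which
contain at least `k - 1` of the first `k` elements. It is the cycle matroid of a cycle of length
`k + 1` in which one edge is replaced by `n - k` parallel copies. -/
def minimalMatroid (k n : ℕ) (h : k ≤ n) : Matroid (Fin n) :=
  Matroid.ofIsBaseOfFinite (E := Set.univ) Set.finite_univ
    (fun B => B.ncard = k ∧ k ≤ (B ∩ {i : Fin n | (i : ℕ) < k}).ncard + 1)
    (by
      have hcard : {i : Fin n | (i : ℕ) < k}.ncard = k := by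
        have : {i : Fin n | (i : ℕ) < k} = Set.range (Fin.castLE h) := by
          ext i
          simp only [Set.mem_ofPred_eq, Set.mem_range]
          exact ⟨fun hi => ⟨⟨i, hi⟩, rfl⟩, by rintro ⟨j, rfl⟩; exact j.2⟩
        rw [this, ← Set.image_univ, Set.ncard_image_of_injective _ (Fin.castLE_injective h)]
        simp
      exact ⟨{i : Fin n | (i : ℕ) < k}, hcard, by rw [Set.inter_self, hcard]; omega⟩)
    (by
      rintro B₁ B₂ ⟨h₁, h₁'⟩ ⟨h₂, h₂'⟩ a ⟨ha₁, ha₂⟩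
      generalize {i : Fin n | (i : ℕ) < k} = S at *
      have hsym : (B₂ \ B₁).ncard = (B₁ \ B₂).ncard := by
        have e₁ := Set.ncard_inter_add_ncard_sdiff_eq_ncard B₁ B₂
        have e₂ := Set.ncard_inter_add_ncard_sdiff_eq_ncard B₂ B₁
        rw [Set.inter_comm] at e₂
        omega
      have hpos : 0 < (B₁ \ B₂).ncard := (Set.ncard_pos).2 ⟨a, ha₁, ha₂⟩
      have hins : ∀ b ∈ B₂ \ B₁, (insert b (B₁ \ {a})).ncard = k := fun b hb => by
        rw [Set.ncard_insert_of_notMem (fun hb' => hb.2 hb'.1)]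
        have := Set.ncard_sdiff_singleton_add_one ha₁
        omega
      by_cases hS : ∃ b ∈ B₂ \ B₁, b ∈ S
      · obtain ⟨b, hb, hbS⟩ := hS
        refine ⟨b, hb, hins b hb, ?_⟩
        have hsub : insert b ((B₁ ∩ S) \ {a}) ⊆ insert b (B₁ \ {a}) ∩ S := by
          rintro x (rfl | ⟨⟨hx, hxS⟩, hxa⟩)
          · exact ⟨Or.inl rfl, hbS⟩
          · exact ⟨Or.inr ⟨hx, hxa⟩, hxS⟩
        have c₁ := Set.ncard_le_ncard hsub
        rw [Set.ncard_insert_of_notMem (fun hb' => hb.2 hb'.1.1)] at c₁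
        have c₂ := Set.pred_ncard_le_ncard_sdiff_singleton (B₁ ∩ S) a
        omega
      · push Not at hS
        obtain ⟨b, hb⟩ := (Set.ncard_pos).1 (hsym ▸ hpos)
        refine ⟨b, hb, ?_⟩
        have hle : (B₂ \ B₁).ncard ≤ 1 := by
          have c₁ : (B₂ \ B₁).ncard ≤ (B₂ \ S).ncard :=
            Set.ncard_le_ncard fun x hx => ⟨hx.1, hS x hx⟩
          have c₂ := Set.ncard_inter_add_ncard_sdiff_eq_ncard B₂ S
          omega
        have hsub : B₂ ⊆ insert b (B₁ \ {a}) := by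
          intro x hx
          by_cases hx₁ : x ∈ B₁
          · exact Or.inr ⟨hx₁, fun hxa => ha₂ (hxa ▸ hx)⟩
          · exact Or.inl ((Set.ncard_le_one).1 hle x ⟨hx, hx₁⟩ b hb)
        have heq := Set.eq_of_subset_of_ncard_le hsub (by rw [hins b hb, h₂])
        rw [← heq]
        exact ⟨h₂, h₂'⟩)
    (fun _ _ => Set.subset_univ _)

/-- The direct sum `U_{0,m} ⊕ T_{a,b} ⊕ U_{l,l}`: the minimal matroid `T_{a,b}` with `m` loops and
`l` coloops added. -/
def minimalWithLoopsColoops (m a b l : ℕ) (h : a ≤ b) : Matroid (Fin m ⊕ (Fin b ⊕ Fin l)) :=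
  (loopyOn (Set.univ : Set (Fin m))).sum
    ((minimalMatroid a b h).sum (freeOn (Set.univ : Set (Fin l))))

end Matroid

/-! Put u = x - 1, v = y - 1 and fix a base B of M. Expanding a product over the elements shows that
x^k y^(n-k) is the sum of u^|B \ A| v^|A \ B| over all A, and each summand is the Tutte summand of A
times (uv)^d, where d = r(A) - |A ∩ B|. Hence x^k y^(n-k) - T_M is uv - 1 times a polynomial of
degree below k in x and below n - k in y (`sub_tutte_mem`). For a minimal matroid with l coloops and
m loops added, a suitable B makes d equal to 0 or 1, and the cofactor is (x^k - x^l)(y^(n-k) - y^m)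
/ (uv) (`IsColoring.mul_sub_tutte`). Mixed differences of these cofactors in l and m are the
monomials x^i y^j with i < k and j < n - k, while l = k, m = n - k gives x^k y^(n-k) itself. This
proves existence (`tutte_mem_span`). For uniqueness, evaluation at x = y = 2 shows that the
coefficients of a relation sum to zero, and the coefficient of x^l y^m in the products then isolates
one class at a time (`linearIndependent_tutte`).

The classification is carried by colorings of the ground set by loops, path elements, parallel
elements and coloops. A colored matroid has at most three cyclic flats and is the cycle matroid of
an explicit graph. Conversely, graphic matroids are binary, so a chord of a circuit C, neither a
loop nor parallel to an element of C, would split C into two circuits with incomparable closures;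
likewise two distinct nontrivial parallel classes would be incomparable. A circuit with largest
closure therefore determines a coloring (`IsGraphic.exists_isNormalColoring`). The link between
graphs and matroids is that cycles are the minimal nonempty even edge sets, with evenness tested by
coboundaries modulo two. -/

namespace Graph

/-! ### Even edge sets and cycles of a multigraph. -/

variable {V α : Type*} {G : Graph V α}

open Classical in
/-- The value of the coboundary of `w` on the edge `e`, modulo two: the sum of `w` over the two
ends of `e`. -/
noncomputable def coboundary (G : Graph V α) (w : V → ZMod 2) (e : α) : ZMod 2 :=
  if h : ∃ p : V × V, G.IsLink e p.1 p.2 then w h.choose.1 + w h.choose.2 else 0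

theorem IsLink.coboundary_eq {e : α} {x y : V} (h : G.IsLink e x y) (w : V → ZMod 2) :
    G.coboundary w e = w x + w y := by
  have hex : ∃ p : V × V, G.IsLink e p.1 p.2 := ⟨(x, y), h⟩
  rw [coboundary, dif_pos hex]
  rcases h.eq_and_eq_or_eq_and_eq hex.choose_spec with ⟨h1, h2⟩ | ⟨h1, h2⟩
  · rw [← h1, ← h2]
  · rw [← h1, ← h2, add_comm]

/-- A finite set of edges is even if every coboundary sums to zero over it, that is, if it meets
every vertex an even number of times. -/
def IsEven (G : Graph V α) (D : Finset α) : Prop :=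
  (D : Set α) ⊆ G.edgeSet ∧ ∀ w : V → ZMod 2, ∑ e ∈ D, G.coboundary w e = 0

/-- A vanishing sum cannot have exactly one nonzero term. With `w` the indicator of a vertex, this
lets a walk that enters the vertex leave it by a different edge. -/
theorem IsEven.exists_ne {D : Finset α} (hD : G.IsEven D) (w : V → ZMod 2) {e : α} (he : e ∈ D)
    (hw : G.coboundary w e ≠ 0) : ∃ f ∈ D, f ≠ e ∧ G.coboundary w f ≠ 0 := by
  by_contra! h
  refine hw ?_
  rw [← hD.2 w]
  exact (Finset.sum_eq_single_of_mem e he fun f hf hfe => h f hf hfe).symm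

open Classical in
theorem IsEven.symmDiff {D D' : Finset α} (hD : G.IsEven D) (hD' : G.IsEven D') :
    G.IsEven (symmDiff D D') := by
  refine ⟨fun e he => ?_, fun w => ?_⟩
  · rcases Finset.mem_symmDiff.1 (Finset.mem_coe.1 he) with h | h
    · exact hD.1 h.1
    · exact hD'.1 h.1
  · have h1 := Finset.sum_inter_add_sum_sdiff D D' (G.coboundary w)
    have h2 := Finset.sum_inter_add_sum_sdiff D' D (G.coboundary w)
    have h3 : ∑ e ∈ _root_.symmDiff D D', G.coboundary w e
        = ∑ e ∈ D \ D', G.coboundary w e + ∑ e ∈ D' \ D, G.coboundary w e :=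
      Finset.sum_union (by
        rw [Finset.disjoint_left]; intro a ha hb; simp_all)
    rw [Finset.inter_comm] at h2
    rw [hD.2] at h1
    rw [hD'.2] at h2
    rw [h3]
    have h4 := CharTwo.add_self_eq_zero (∑ e ∈ D ∩ D', G.coboundary w e)
    linear_combination h1 + h2 - h4

theorem IsCycleEdgeSet.finite {C : Set α} (hC : G.IsCycleEdgeSet C) : C.Finite := by
  obtain ⟨r, v, e, -, -, -, rfl⟩ := hC
  exact Set.finite_range e

theorem IsCycleEdgeSet.nonempty {C : Set α} (hC : G.IsCycleEdgeSet C) : C.Nonempty := by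
  obtain ⟨r, v, e, -, -, -, rfl⟩ := hC
  exact Set.range_nonempty e

theorem IsCycleEdgeSet.isEven {C : Finset α} (hC : G.IsCycleEdgeSet (C : Set α)) :
    G.IsEven C := by
  classical
  obtain ⟨r, v, e, -, he, hl, hCe⟩ := hC
  have hCe' : C = Finset.univ.image e := by
    apply Finset.coe_injective
    simp [hCe]
  refine ⟨?_, fun w => ?_⟩
  · rw [hCe]
    rintro _ ⟨i, rfl⟩
    exact (hl i).edge_mem
  · rw [hCe', Finset.sum_image he.injOn]
    simp_rw [fun i => (hl i).coboundary_eq w]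
    have hshift : ∑ i, w (v (i + 1)) = ∑ i, w (v i) :=
      Equiv.sum_comp (Equiv.addRight (1 : Fin (r + 1))) fun i => w (v i)
    rw [Finset.sum_add_distrib, hshift]
    exact CharTwo.add_self_eq_zero _

/-- A cycle contains no smaller nonempty even set. -/
theorem IsCycleEdgeSet.eq_of_isEven {C : Set α} (hC : G.IsCycleEdgeSet C) {D : Finset α}
    (hD : G.IsEven D) (hne : D.Nonempty) (hDC : (D : Set α) ⊆ C) : (D : Set α) = C := by
  classical
  obtain ⟨r, v, e, hv, he, hl, rfl⟩ := hC
  -- Test `D` against the indicator of `v (i + 1)`: within the cycle only `e i` and `e (i + 1)` meet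
  -- this vertex. The case `i + 1 = i` is the loop `r = 0`.
  have step : ∀ i, e i ∈ D → e (i + 1) ∈ D := by
    intro i hi
    by_cases hr : i + 1 = i
    · rwa [hr]
    obtain ⟨f, hf, hfi, hfw⟩ := hD.exists_ne (Pi.single (v (i + 1)) 1) hi (by
      rw [(hl i).coboundary_eq, Pi.single_eq_same, Pi.single_eq_of_ne fun h => hr (hv h).symm]
      simp)
    obtain ⟨j, rfl⟩ := hDC hf
    rw [(hl j).coboundary_eq] at hfw
    by_cases h1 : v j = v (i + 1)
    · rwa [← hv h1]
    · by_cases h2 : v (j + 1) = v (i + 1)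
      · exact absurd (congrArg e (add_right_cancel (hv h2))) hfi
      · rw [Pi.single_eq_of_ne h1, Pi.single_eq_of_ne h2, add_zero] at hfw
        exact absurd rfl hfw
  refine hDC.antisymm ?_
  rintro _ ⟨j, rfl⟩
  obtain ⟨f, hf⟩ := hne
  obtain ⟨i, rfl⟩ := hDC hf
  have key : ∀ n : Fin (r + 1), e (i + n) ∈ D := by
    intro n
    induction n using Fin.induction with
    | zero => simpa using hf
    | succ n ih =>
      have := step _ ih
      rwa [add_assoc, Fin.coeSucc_eq_succ] at this
  have := key (j - i)
  rwa [add_sub_cancel] at this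

theorem finite_setOf_exists_isLink (G : Graph V α) (D : Finset α) :
    {x : V | ∃ e ∈ D, ∃ y, G.IsLink e x y}.Finite := by
  have : {x : V | ∃ e ∈ D, ∃ y, G.IsLink e x y} = ⋃ e ∈ D, {x | ∃ y, G.IsLink e x y} := by
    ext x
    simp
  rw [this]
  refine D.finite_toSet.biUnion fun e _ => ?_
  by_cases h : ∃ x y, G.IsLink e x y
  · obtain ⟨x, y, hxy⟩ := h
    refine (Set.toFinite {x, y}).subset ?_
    rintro z ⟨t, ht⟩
    exact ht.left_eq_or_eq hxy
  · push Not at h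
    convert Set.finite_empty
    ext x
    simpa using h x

/-- A walk in a finite set of edges which never traverses the same edge twice in a row goes around
a cycle. -/
theorem exists_isCycleEdgeSet_subset_of_walk {D : Finset α} {v : ℕ → V} {ε : ℕ → α}
    (hD : ∀ n, ε n ∈ D) (hl : ∀ n, G.IsLink (ε n) (v n) (v (n + 1)))
    (hε : ∀ n, ε n ≠ ε (n + 1)) : ∃ C ⊆ (D : Set α), G.IsCycleEdgeSet C := by
  classical
  -- Only finitely many vertices are available, so some vertex recurs. The least return time `m`
  -- over all starting points makes the vertices in between distinct.
  have hex : ∃ m, 0 < m ∧ ∃ i, v i = v (i + m) := by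
    have hfin := G.finite_setOf_exists_isLink D
    have := hfin.to_subtype
    obtain ⟨i, j, hij, h⟩ := Finite.exists_ne_map_eq_of_infinite
      (fun n => (⟨v n, ε n, hD n, _, hl n⟩ : {x : V | ∃ e ∈ D, ∃ y, G.IsLink e x y}))
    have h' : v i = v j := congrArg Subtype.val h
    rcases lt_or_gt_of_ne hij with hlt | hlt
    · exact ⟨j - i, by omega, i, by rw [h']; congr 1; omega⟩
    · exact ⟨i - j, by omega, j, by rw [← h']; congr 1; omega⟩
  obtain ⟨hm, i, hi⟩ := Nat.find_spec hex
  have hmin : ∀ a b, a < b → b < a + Nat.find hex → v a ≠ v b := by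
    intro a b hab hb h
    refine Nat.find_min hex (m := b - a) (by omega) ⟨by omega, a, ?_⟩
    rw [h]; congr 1; omega
  generalize Nat.find hex = m at *
  obtain ⟨r, rfl⟩ : ∃ r, m = r + 1 := ⟨m - 1, by omega⟩
  refine ⟨Set.range fun a : Fin (r + 1) => ε (i + a), ?_, r, fun a => v (i + a),
    fun a => ε (i + a), ?_, ?_, ?_, rfl⟩
  · rintro _ ⟨a, rfl⟩
    exact hD _
  · intro a b hab
    by_contra hne
    rcases lt_or_gt_of_ne (fun h => hne (Fin.ext h) : (a : ℕ) ≠ b) with h | h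
    · exact hmin _ _ (by omega) (by omega) hab
    · exact hmin _ _ (by omega) (by omega) hab.symm
  · have main : ∀ a b : Fin (r + 1), (a : ℕ) < b → ε (i + a) ≠ ε (i + b) := by
      intro a b hab h
      have h1 := hl (i + a)
      rw [h] at h1
      rcases h1.eq_and_eq_or_eq_and_eq (hl (i + b)) with ⟨h2, -⟩ | ⟨-, h2⟩
      · exact hmin _ _ (by omega) (by omega) h2
      -- The edge is traversed in opposite directions: either the two traversals are consecutive,
      -- which `hε` forbids, or a vertex recurs too early.
      · by_cases hb : i + a + 1 = i + b
        · exact hε (i + a) (by rw [hb, h])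
        · exact hmin _ _ (by omega) (by omega) h2
    intro a b hab
    by_contra hne
    rcases lt_or_gt_of_ne (fun h => hne (Fin.ext h) : (a : ℕ) ≠ b) with h | h
    · exact main a b h hab
    · exact main b a h hab.symm
  · intro a
    have := hl (i + a)
    by_cases ha : a = Fin.last r
    · subst ha
      have h0 : v (i + (Fin.last r : ℕ) + 1) = v i := by
        rw [hi]; congr 1
      rw [h0] at this
      simpa using this
    · have h1 : ((a + 1 : Fin (r + 1)) : ℕ) = a + 1 :=
        Fin.val_add_one_of_lt (Fin.lt_last_iff_ne_last.2 ha)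
      simpa [h1, add_assoc] using this

/-- A nonempty even set contains a cycle. -/
theorem IsEven.exists_isCycleEdgeSet_subset {D : Finset α} (hD : G.IsEven D)
    (hne : D.Nonempty) : ∃ C ⊆ (D : Set α), G.IsCycleEdgeSet C := by
  classical
  by_cases hloop : ∃ e ∈ D, ∃ x, G.IsLink e x x
  · obtain ⟨e, he, x, hx⟩ := hloop
    refine ⟨{e}, by simpa using he, 0, fun _ => x, fun _ => e, ?_, ?_, fun _ => hx, ?_⟩
    · exact fun i j _ => Fin.ext (by omega)
    · exact fun i j _ => Fin.ext (by omega)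
    · simp
  push Not at hloop
  -- States are directed edges of `D`. Since loops are excluded, the indicator of the head is
  -- nonzero on the current edge, so evenness supplies another edge at the head.
  have next : ∀ t : {t : V × α × V // t.2.1 ∈ D ∧ G.IsLink t.2.1 t.1 t.2.2},
      ∃ t' : {t : V × α × V // t.2.1 ∈ D ∧ G.IsLink t.2.1 t.1 t.2.2},
        t'.1.1 = t.1.2.2 ∧ t.1.2.1 ≠ t'.1.2.1 := by
    rintro ⟨⟨x, e, y⟩, he, hl⟩
    simp only at he hl
    have hxy : x ≠ y := fun h => hloop e he y (h ▸ hl)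
    obtain ⟨f, hf, hfe, hfw⟩ := hD.exists_ne (Pi.single y 1) he (by
      rw [hl.coboundary_eq, Pi.single_eq_same, Pi.single_eq_of_ne hxy]
      simp)
    obtain ⟨p, q, hpq⟩ := (G.edge_mem_iff_exists_isLink f).1 (hD.1 hf)
    rw [hpq.coboundary_eq] at hfw
    by_cases h1 : p = y
    · exact ⟨⟨(p, f, q), hf, hpq⟩, h1, hfe.symm⟩
    · by_cases h2 : q = y
      · exact ⟨⟨(q, f, p), hf, hpq.symm⟩, h2, hfe.symm⟩
      · rw [Pi.single_eq_of_ne h1, Pi.single_eq_of_ne h2, add_zero] at hfw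
        exact absurd rfl hfw
  choose nx hnx hnx' using next
  obtain ⟨e, he⟩ := hne
  obtain ⟨x, y, hxy⟩ := (G.edge_mem_iff_exists_isLink e).1 (hD.1 he)
  let s := fun n : ℕ => nx^[n] ⟨(x, e, y), he, hxy⟩
  have hs : ∀ n, s (n + 1) = nx (s n) := fun n => Function.iterate_succ_apply' _ _ _
  refine exists_isCycleEdgeSet_subset_of_walk (v := fun n => (s n).1.1) (ε := fun n => (s n).1.2.1)
    (fun n => (s n).2.1) (fun n => ?_) (fun n => ?_)
  · have := (s n).2.2
    simp only [hs, hnx]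
    exact this
  · simp only [hs]
    exact hnx' (s n)

end Graph

/-- The graph with vertex type `V` in which each edge `e ∈ E` joins `s e` and `t e`. -/
def Graph.ofEnds {V α : Type*} (E : Set α) (s t : α → V) : Graph V α where
  vertexSet := Set.univ
  IsLink e x y := e ∈ E ∧ (s e = x ∧ t e = y ∨ s e = y ∧ t e = x)
  edgeSet := E
  isLink_symm := fun e _ => ⟨fun x y h => ⟨h.1, h.2.symm⟩⟩
  eq_or_eq_of_isLink_of_isLink := by grind
  edge_mem_iff_exists_isLink := fun e =>
    ⟨fun h => ⟨s e, t e, h, Or.inl ⟨rfl, rfl⟩⟩, fun ⟨_, _, h⟩ => h.1⟩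
  left_mem_of_isLink := fun _ _ _ _ => Set.mem_univ _

theorem Graph.ofEnds_coboundary {V α : Type*} {E : Set α} {s t : α → V} {e : α} (he : e ∈ E)
    (w : V → ZMod 2) : (Graph.ofEnds E s t).coboundary w e = w (s e) + w (t e) :=
  Graph.IsLink.coboundary_eq (G := Graph.ofEnds E s t) ⟨he, Or.inl ⟨rfl, rfl⟩⟩ w

/-- A finite set can be numbered consecutively. -/
theorem Set.Finite.exists_bijOn_Iio {α : Type*} {S : Set α} (hS : S.Finite) :
    ∃ (a : ℕ) (φ : α → ℕ), Set.BijOn φ S (Set.Iio a) := by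
  classical
  have := hS.to_subtype
  obtain ⟨a, ⟨g⟩⟩ := Finite.exists_equiv_fin S
  refine ⟨a, fun x => if h : x ∈ S then g ⟨x, h⟩ else 0, ?_, ?_, ?_⟩
  · intro x hx
    simp [hx]
  · intro x hx y hy hxy
    simp only [hx, hy, dif_pos] at hxy
    simpa using g.injective (Fin.ext hxy)
  · intro i hi
    exact ⟨g.symm ⟨i, hi⟩, (g.symm ⟨i, hi⟩).2, by simp⟩

namespace Matroid

variable {α : Type*} {M : Matroid α}

/-- Each circuit contains a cycle and each cycle contains a circuit; minimality of circuits among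
dependent sets and of cycles among nonempty even sets turns both inclusions into equalities. -/
theorem isGraphic_of_isEven [M.Finite] {V : Type} (G : Graph V α) (hE : G.edgeSet = M.E)
    (hcirc : ∀ C : Finset α, M.IsCircuit C → G.IsEven C)
    (heven : ∀ D : Finset α, G.IsEven D → D.Nonempty → ¬ M.Indep D) : M.IsGraphic := by
  refine ⟨V, G, hE, fun C => ⟨fun hC => ?_, fun hC => ?_⟩⟩
  · obtain ⟨C, rfl⟩ := (M.ground_finite.subset hC.subset_ground).exists_finset_coe
    obtain ⟨K, hKC, hK⟩ := (hcirc C hC).exists_isCycleEdgeSet_subset (by simpa using hC.nonempty)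
    obtain ⟨K, rfl⟩ := hK.finite.exists_finset_coe
    rwa [← hC.eq_of_not_indep_subset (heven K hK.isEven (by simpa using hK.nonempty)) hKC]
  · obtain ⟨C, rfl⟩ := hC.finite.exists_finset_coe
    have hCE := hC.isEven
    have hdep : M.Dep C := ⟨heven C hCE (by simpa using hC.nonempty), hE ▸ hCE.1⟩
    obtain ⟨K, hKC, hK⟩ := hdep.exists_isCircuit_subset
    obtain ⟨K, rfl⟩ := (C.finite_toSet.subset hKC).exists_finset_coe
    rwa [← hC.eq_of_isEven (hcirc K hK) (by simpa using hK.nonempty) hKC]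

end Matroid

/-! ### Colored matroids are graphic and Schubert. -/

/-- The kinds of elements of a minimal matroid with added loops and coloops. -/
inductive ElementKind
  | loop
  | path
  | parallel
  | coloop
  deriving DecidableEq

namespace Matroid

open ElementKind

variable {α : Type*} {M : Matroid α} {κ : α → ElementKind}

/-- The map `κ` exhibits `M` as a minimal matroid with added loops and coloops: it is the cycle
matroid of a cycle formed by the path elements and one further edge which is replaced by the
parallel elements, with loops and coloops added. -/
def IsColoring (M : Matroid α) (κ : α → ElementKind) : Prop :=
  ∀ I ⊆ M.E, M.Indep I ↔ (∀ e ∈ I, κ e ≠ loop) ∧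
    (∀ e ∈ I, ∀ f ∈ I, κ e = parallel → κ f = parallel → e = f) ∧
    (∀ e ∈ I, κ e = parallel → ∃ p ∈ M.E, κ p = path ∧ p ∉ I)

namespace IsColoring

theorem isLoop (h : M.IsColoring κ) {e : α} (he : e ∈ M.E) (hκ : κ e = loop) : M.IsLoop e := by
  rw [← singleton_not_indep he, h _ (by simpa using he)]
  simp [hκ]

theorem pair_dep (h : M.IsColoring κ) {e f : α} (he : e ∈ M.E) (hf : f ∈ M.E)
    (hκe : κ e = parallel) (hκf : κ f = parallel) (hne : e ≠ f) : M.Dep {e, f} := by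
  have hE : {e, f} ⊆ M.E := Set.insert_subset he (by simpa using hf)
  refine ⟨fun hi => hne ?_, hE⟩
  exact ((h _ hE).1 hi).2.1 e (by simp) f (by simp) hκe hκf

theorem insert_path_dep (h : M.IsColoring κ) {e : α} (he : e ∈ M.E) (hκ : κ e = parallel) :
    M.Dep (insert e {p ∈ M.E | κ p = path}) := by
  have hE : insert e {p ∈ M.E | κ p = path} ⊆ M.E := Set.insert_subset he fun p hp => hp.1
  refine ⟨fun hi => ?_, hE⟩
  obtain ⟨p, hp, hκp, hpI⟩ := ((h _ hE).1 hi).2.2 e (by simp) hκ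
  exact hpI (Or.inr ⟨hp, hκp⟩)

/-- Each clause of `IsColoring` can only fail through one of three explicit dependent sets, and a
circuit containing one of them equals it. The list may include noncircuits: without path elements
every parallel element is a loop. -/
theorem isCircuit_cases (h : M.IsColoring κ) {C : Set α} (hC : M.IsCircuit C) :
    (∃ e, κ e = loop ∧ C = {e}) ∨
    (∃ e f, κ e = parallel ∧ κ f = parallel ∧ e ≠ f ∧ C = {e, f}) ∨
    ∃ e, κ e = parallel ∧ C = insert e {p ∈ M.E | κ p = path} := by
  have hE := hC.subset_ground
  by_contra! hcon
  obtain ⟨h1, h2, h3⟩ := hcon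
  refine hC.not_indep ((h C hE).2 ⟨fun e he hκ => ?_, fun e he f hf hκe hκf => ?_,
    fun e he hκ => ?_⟩)
  · exact h1 e hκ (hC.eq_of_dep_subset (singleton_dep.2 (h.isLoop (hE he) hκ)) (by simpa)).symm
  · by_contra hne
    exact h2 e f hκe hκf hne (hC.eq_of_dep_subset (h.pair_dep (hE he) (hE hf) hκe hκf hne)
      (Set.insert_subset he (by simpa))).symm
  · by_contra! hp
    exact h3 e hκ (hC.eq_of_dep_subset (h.insert_path_dep (hE he) hκ)
      (Set.insert_subset he fun p hp' => hp p hp'.1 hp'.2)).symm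

/-- A cyclic flat contains all loops and no coloops; one parallel element forces all of them, and
one path element forces all path and parallel elements. The possible flats are thus nested. -/
theorem isSchubert (h : M.IsColoring κ) : M.IsSchubert := by
  have hcol : ∀ F, M.IsCyclicFlat F → ∀ e ∈ F, κ e ≠ coloop := by
    intro F hF e he hκ
    obtain ⟨C, -, hC, heC⟩ := hF.2 e he
    rcases h.isCircuit_cases hC with ⟨f, hf, rfl⟩ | ⟨f, g, hf, hg, -, rfl⟩ | ⟨f, hf, rfl⟩
    · grind
    · grind
    · grind
  have hloop : ∀ F, M.IsCyclicFlat F → ∀ e ∈ M.E, κ e = loop → e ∈ F :=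
    fun F hF e he hκ => (h.isLoop he hκ).mem_of_isFlat hF.1
  have hpar : ∀ F, M.IsCyclicFlat F → ∀ e ∈ F, κ e = parallel →
      ∀ f ∈ M.E, κ f = parallel → f ∈ F := by
    intro F hF e he hκe f hf hκf
    have heE := hF.1.subset_ground he
    by_cases hi : M.Indep {e}
    · by_cases hef : f = e
      · rwa [hef]
      have : f ∈ M.closure {e} :=
        hi.mem_closure_iff.2 (Or.inl (h.pair_dep hf heE hκf hκe hef))
      rw [← hF.1.closure]
      exact M.closure_subset_closure (by simpa using he) this
    -- A parallel element is a loop only if there are no path elements, and then all parallel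
    -- elements are loops.
    · refine IsLoop.mem_of_isFlat ?_ hF.1
      rw [← singleton_not_indep hf]
      rw [h _ (by simpa using heE)] at hi
      rw [h _ (by simpa using hf)]
      contrapose! hi
      refine ⟨by simp [hκe], by simp, ?_⟩
      obtain ⟨p, hp, hκp, -⟩ := hi.2.2 f rfl hκf
      exact fun _ _ _ => ⟨p, hp, hκp, by rintro rfl; simp_all⟩
  have hpath : ∀ F, M.IsCyclicFlat F → ∀ e ∈ F, κ e = path →
      (∀ f ∈ M.E, κ f = path → f ∈ F) ∧ (∀ f ∈ M.E, κ f = parallel → f ∈ F) := by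
    intro F hF e he hκ
    obtain ⟨C, hCF, hC, heC⟩ := hF.2 e he
    rcases h.isCircuit_cases hC with ⟨f, hf, rfl⟩ | ⟨f, g, hf, hg, -, rfl⟩ | ⟨f, hf, rfl⟩
    · grind
    · grind
    · exact ⟨fun g hg hκg => hCF (Or.inr ⟨hg, hκg⟩), hpar F hF f (hCF (by simp)) hf⟩
  intro F hF F' hF' _
  have hFE := hF.1.subset_ground
  have hFE' := hF'.1.subset_ground
  have key : ∀ A, M.IsCyclicFlat A → ∀ B, M.IsCyclicFlat B → (∃ e ∈ A, κ e = path) → B ⊆ A := by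
    rintro A hA B hB ⟨p, hp, hκp⟩ e he
    have heE := hB.1.subset_ground he
    cases hκ : κ e with
    | loop => exact hloop A hA e heE hκ
    | path => exact (hpath A hA p hp hκp).1 e heE hκ
    | parallel => exact (hpath A hA p hp hκp).2 e heE hκ
    | coloop => exact absurd hκ (hcol B hB e he)
  by_cases h1 : ∃ e ∈ F, κ e = path
  · exact Or.inr (key F hF F' hF' h1)
  by_cases h2 : ∃ e ∈ F', κ e = path
  · exact Or.inl (key F' hF' F hF h2)
  push Not at h1 h2
  by_cases h3 : ∃ e ∈ F, κ e = parallel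
  · right
    obtain ⟨q, hq, hκq⟩ := h3
    intro e he
    cases hκ : κ e with
    | loop => exact hloop F hF e (hFE' he) hκ
    | path => exact absurd hκ (h2 e he)
    | parallel => exact hpar F hF q hq hκq e (hFE' he) hκ
    | coloop => exact absurd hκ (hcol F' hF' e he)
  · left
    push Not at h3
    intro e he
    cases hκ : κ e with
    | loop => exact hloop F' hF' e (hFE he) hκ
    | path => exact absurd hκ (h1 e he)
    | parallel => exact absurd hκ (h3 e he)
    | coloop => exact absurd hκ (hcol F hF e he)

/-- If the path elements are numbered by `φ` and the coloops by `ψ`, these are the ends of the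
edges of a graph: the path elements run from `0` to `a`, the parallel elements join `0` and `a`,
and the coloops are pendant edges at `a`. -/
def ends (κ : α → ElementKind) (a : ℕ) (φ ψ : α → ℕ) (e : α) : ℕ × ℕ :=
  match κ e with
  | loop => (0, 0)
  | path => (φ e, φ e + 1)
  | parallel => (0, a)
  | coloop => (a, a + 1 + ψ e)

theorem sum_ends_path {P : Finset α} {a : ℕ} {φ : α → ℕ} (hφ : Set.BijOn φ P (Set.Iio a))
    (w : ℕ → ZMod 2) : ∑ e ∈ P, (w (φ e) + w (φ e + 1)) = w 0 + w a := by
  have h1 : ∑ e ∈ P, (w (φ e) + w (φ e + 1)) = ∑ i ∈ Finset.range a, (w i + w (i + 1)) := by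
    refine Finset.sum_nbij φ ?_ hφ.injOn ?_ fun _ _ => rfl
    · intro e he
      simpa using hφ.mapsTo he
    · simpa using hφ.surjOn
  have h2 := Finset.sum_range_sub w a
  simp_rw [CharTwo.sub_eq_add] at h2
  rw [h1, add_comm (w 0), ← h2]
  exact Finset.sum_congr rfl fun _ _ => add_comm _ _

/-- In the graph given by `ends`, the coboundary over the path telescopes, so circuits are even. An
independent even set is emptied by testing it against cuts, first excluding parallel elements, then
path elements, then coloops. -/
theorem isGraphic [M.Finite] (h : M.IsColoring κ) : M.IsGraphic := by
  classical
  obtain ⟨a, φ, hφ⟩ := (M.ground_finite.subset (Set.sep_subset M.E fun e => κ e = path)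
    ).exists_bijOn_Iio
  obtain ⟨b, ψ, hψ⟩ := (M.ground_finite.subset (Set.sep_subset M.E fun e => κ e = coloop)
    ).exists_bijOn_Iio
  set G := Graph.ofEnds M.E (fun e => (ends κ a φ ψ e).1) (fun e => (ends κ a φ ψ e).2) with hG
  have hcob : ∀ w, ∀ e ∈ M.E, G.coboundary w e
      = w (ends κ a φ ψ e).1 + w (ends κ a φ ψ e).2 :=
    fun w e he => Graph.ofEnds_coboundary he w
  refine isGraphic_of_isEven G rfl (fun C hC => ⟨hC.subset_ground, fun w => ?_⟩)
    (fun D hD hne hi => ?_)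
  · rw [Finset.sum_congr rfl fun e he => hcob w e (hC.subset_ground he)]
    rcases h.isCircuit_cases hC with ⟨f, hf, hCf⟩ | ⟨f, g, hf, hg, hfg, hCf⟩ | ⟨f, hf, hCf⟩
    · obtain rfl : C = {f} := by exact_mod_cast hCf
      simp [ends, hf, CharTwo.add_self_eq_zero]
    · obtain rfl : C = {f, g} := by exact_mod_cast hCf
      rw [Finset.sum_pair hfg]
      simp [ends, hf, hg, CharTwo.add_self_eq_zero]
    · have hP : ((C.erase f : Finset α) : Set α) = {p ∈ M.E | κ p = path} := by
        rw [Finset.coe_erase, hCf]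
        ext x
        simp only [Set.mem_sdiff, Set.mem_insert_iff, Set.mem_singleton_iff]
        grind
      have hfC : f ∈ C := by
        rw [← Finset.mem_coe, hCf]; simp
      rw [← Finset.add_sum_erase _ _ hfC, Finset.sum_congr (g := fun e => w (φ e) + w (φ e + 1)) rfl,
        sum_ends_path (hP ▸ hφ)]
      · simp [ends, hf, CharTwo.add_self_eq_zero]
      · intro e he
        have : e ∈ {p ∈ M.E | κ p = path} := hP ▸ he
        simp [ends, this.2]
  · have hDE : (D : Set α) ⊆ M.E := hD.1
    obtain ⟨i1, i2, i3⟩ := (h D hDE).1 hi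
    have hsum : ∀ w : ℕ → ZMod 2,
        ∑ e ∈ D, (w (ends κ a φ ψ e).1 + w (ends κ a φ ψ e).2) = 0 := by
      intro w
      rw [← hD.2 w]
      exact Finset.sum_congr rfl fun e he => (hcob w e (hDE he)).symm
    have hone : ∀ (w : ℕ → ZMod 2), ∀ e ∈ D, w (ends κ a φ ψ e).1 + w (ends κ a φ ψ e).2 = 1 →
        ∃ f ∈ D, f ≠ e ∧ w (ends κ a φ ψ f).1 + w (ends κ a φ ψ f).2 ≠ 0 := by
      intro w e he hw
      by_contra! hcon
      have := hsum w
      rw [Finset.sum_eq_single_of_mem e he hcon, hw] at this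
      exact one_ne_zero this
    have hpath_lt : ∀ e ∈ D, κ e = path → φ e < a := fun e he hκ => hφ.mapsTo ⟨hDE he, hκ⟩
    have hpar : ∀ q ∈ D, κ q ≠ parallel := by
      intro q hq hκ
      obtain ⟨p, hp, hκp, hpD⟩ := i3 q hq hκ
      have hpa : φ p < a := hφ.mapsTo ⟨hp, hκp⟩
      -- The cut between `φ p` and `φ p + 1` is crossed only by `p` and the parallel elements. As
      -- `p` is missing from `D`, and `q` is the only parallel element there, `q` would cross alone.
      obtain ⟨f, hf, hfq, hw⟩ := hone (fun j => if j ≤ φ p then 1 else 0) q hq (by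
        simp [ends, hκ, hpa])
      apply hw
      cases hκf : κ f with
      | loop => exact absurd hκf (i1 f hf)
      | path =>
        have hne : φ f ≠ φ p := fun hh => hpD (by
          have := hφ.injOn ⟨hDE hf, hκf⟩ ⟨hp, hκp⟩ hh
          exact this ▸ hf)
        simp only [ends, hκf]
        by_cases hlt : φ f < φ p
        · rw [if_pos hlt.le, if_pos (by omega)]; decide
        · rw [if_neg (by omega), if_neg (by omega)]; decide
      | parallel => exact absurd (i2 f hf q hq hκf hκ) hfq
      | coloop =>
        simp only [ends, hκf]
        rw [if_neg (by omega), if_neg (by omega)]; decide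
    have hpath : ∀ p ∈ D, κ p ≠ path := by
      intro p hp hκp
      have hpa := hpath_lt p hp hκp
      -- The same cut, now crossed by `p` alone because parallel elements are already excluded.
      obtain ⟨f, hf, hfp, hw⟩ := hone (fun j => if j ≤ φ p then 1 else 0) p hp (by
        simp [ends, hκp])
      apply hw
      cases hκf : κ f with
      | loop => exact absurd hκf (i1 f hf)
      | path =>
        have hne : φ f ≠ φ p := fun hh => hfp (hφ.injOn ⟨hDE hf, hκf⟩ ⟨hDE hp, hκp⟩ hh)
        simp only [ends, hκf]
        by_cases hlt : φ f < φ p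
        · rw [if_pos hlt.le, if_pos (by omega)]; decide
        · rw [if_neg (by omega), if_neg (by omega)]; decide
      | parallel => exact absurd hκf (hpar f hf)
      | coloop =>
        simp only [ends, hκf]
        rw [if_neg (by omega), if_neg (by omega)]; decide
    obtain ⟨c, hc⟩ := hne
    have hcoloop : ∀ e ∈ D, κ e = coloop := by
      intro e he
      cases hκ : κ e with
      | loop => exact absurd hκ (i1 e he)
      | path => exact absurd hκ (hpath e he)
      | parallel => exact absurd hκ (hpar e he)
      | coloop => rfl
    -- The indicator of the leaf at the free end of the pendant edge `c`.
    obtain ⟨f, hf, hfc, hw⟩ := hone (fun j => if j = a + 1 + ψ c then 1 else 0) c hc (by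
      simp only [ends, hcoloop c hc]
      rw [if_neg (by omega)]
      simp)
    apply hw
    have hne : ψ f ≠ ψ c := fun hh =>
      hfc (hψ.injOn ⟨hDE hf, hcoloop f hf⟩ ⟨hDE hc, hcoloop c hc⟩ hh)
    simp only [ends, hcoloop f hf]
    rw [if_neg (by omega), if_neg (by omega), zero_add]

end IsColoring

end Matroid

namespace Matroid

open ElementKind

variable {α : Type*} {M : Matroid α}

/-- Graphic matroids are binary. -/
theorem IsGraphic.exists_isCircuit_subset_symmDiff (hM : M.IsGraphic) {C D : Set α}
    (hC : M.IsCircuit C) (hD : M.IsCircuit D) (hne : C ≠ D) :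
    ∃ K ⊆ symmDiff C D, M.IsCircuit K := by
  classical
  obtain ⟨V, G, -, hG⟩ := hM
  rw [hG] at hC hD
  obtain ⟨C, rfl⟩ := hC.finite.exists_finset_coe
  obtain ⟨D, rfl⟩ := hD.finite.exists_finset_coe
  obtain ⟨K, hK, hKc⟩ := (hC.isEven.symmDiff hD.isEven).exists_isCycleEdgeSet_subset (by
    rw [Finset.nonempty_iff_ne_empty, ← Finset.bot_eq_empty, ne_eq, symmDiff_eq_bot]
    rintro rfl
    exact hne rfl)
  exact ⟨K, by rwa [← Finset.coe_symmDiff], (hG K).2 hKc⟩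

/-- This supplies the cyclic flats to which the chain condition is applied. -/
theorem IsCircuit.isCyclicFlat_closure {C : Set α} (hC : M.IsCircuit C) :
    M.IsCyclicFlat (M.closure C) := by
  have hsub := M.subset_closure C hC.subset_ground
  refine ⟨M.isFlat_closure C, fun e he => ?_⟩
  by_cases heC : e ∈ C
  · exact ⟨C, hsub, hC, heC⟩
  · obtain ⟨D, hDC, hD, heD⟩ := exists_isCircuit_of_mem_closure he heC
    exact ⟨D, hDC.trans (Set.insert_subset he hsub), hD, heD⟩

/-- Two circuits which meet in a single element `e` outside of the circuit `C`, and lie in the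
union of `C` and `e`, have incomparable closures. -/
theorem IsCircuit.not_subset_closure {C D D' : Set α} {e : α} (hC : M.IsCircuit C)
    (hD' : M.IsCircuit D')
    (hDC : D ⊆ insert e C) (hDC' : D' ⊆ insert e C) (hDD' : ∀ x ∈ D, x ∈ D' → x = e)
    {f g : α} (hf : f ∈ D) (hg : g ∈ D) (hfe : f ≠ e) (hge : g ≠ e) (hfg : f ≠ g) :
    ¬ D ⊆ M.closure D' := by
  intro hsub
  have hfC : f ∈ C := (hDC hf).resolve_left hfe
  have hgC : g ∈ C := (hDC hg).resolve_left hge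
  have h1 : M.Indep (C \ {f}) := hC.sdiff_singleton_indep hfC
  refine h1.notMem_closure_sdiff_of_mem (e := g) ⟨hgC, hfg.symm⟩ ?_
  -- Since `D' \ {e}` spans `D'` and avoids both `f` and `g`, the inclusion would put `g` in the
  -- closure of `C` without `f` and `g`, against independence of `C \ {f}`.
  have h2 : D' \ {e} ⊆ (C \ {f}) \ {g} := by
    rintro x ⟨hx, hxe⟩
    refine ⟨⟨(hDC' hx).resolve_left hxe, ?_⟩, ?_⟩
    · rintro rfl
      exact hxe (hDD' _ hf hx)
    · rintro rfl
      exact hxe (hDD' _ hg hx)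
  refine M.closure_subset_closure h2 ?_
  rw [hD'.closure_sdiff_singleton_eq]
  exact hsub hg

/-- In a graphic Schubert matroid a circuit has no chords: every nonloop that is spanned by a
circuit is parallel to an element of it. -/
theorem IsGraphic.exists_closure_singleton_eq (hM : M.IsGraphic) (hS : M.IsSchubert) {C : Set α}
    (hC : M.IsCircuit C) {e : α} (he : e ∈ M.closure C) (heC : e ∉ C) (hel : M.IsNonloop e) :
    ∃ f ∈ C, M.closure {e} = M.closure {f} := by
  by_contra! hcon
  have hpar : ∀ f ∈ C, ¬ M.IsCircuit {e, f} := by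
    intro f hf hef
    refine hcon f hf ((hel.closure_eq_closure_iff_isCircuit_of_ne ?_).2 hef)
    rintro rfl
    exact heC hf
  have htwo : ∀ D, M.IsCircuit D → e ∈ D → D ⊆ insert e C →
      ∃ f g, f ∈ D ∧ g ∈ D ∧ f ≠ e ∧ g ≠ e ∧ f ≠ g := by
    intro D hD heD hDC
    have h1 : ∃ f ∈ D, f ≠ e := by
      by_contra! h
      have : D = {e} := Set.eq_singleton_iff_unique_mem.2 ⟨heD, h⟩
      rw [this, singleton_isCircuit] at hD
      exact hel.not_isLoop hD
    obtain ⟨f, hf, hfe⟩ := h1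
    by_contra! h
    have : D = {e, f} := by
      ext x
      simp only [Set.mem_insert_iff, Set.mem_singleton_iff]
      refine ⟨fun hx => ?_, ?_⟩
      · by_contra! hx'
        exact hx'.2 (h f x hf hx hfe hx'.1).symm
      · rintro (rfl | rfl) <;> assumption
    exact hpar f ((hDC hf).resolve_left hfe) (this ▸ hD)
  obtain ⟨D, hDC, hD, heD⟩ := exists_isCircuit_of_mem_closure he heC
  obtain ⟨f, g, hf, hg, hfe, hge, hfg⟩ := htwo D hD heD hDC
  have hfC : f ∈ C := (hDC hf).resolve_left hfe
  have hne : D ≠ C := by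
    rintro rfl
    exact heC heD
  -- `D'` is the other half of `C` cut off by the chord `e`. It must contain `e`: otherwise it would
  -- be all of `C`, although it avoids `f ∈ C ∩ D`.
  obtain ⟨D', hD'sub, hD'⟩ := hM.exists_isCircuit_subset_symmDiff hD hC hne
  have hmem : ∀ x ∈ D', x ∈ D ∧ x ∉ C ∨ x ∈ C ∧ x ∉ D := fun x hx => hD'sub hx
  have hD'C : D' ⊆ insert e C := by
    intro x hx
    rcases hmem x hx with h | h
    · exact hDC h.1
    · exact Or.inr h.1
  have heD' : e ∈ D' := by
    by_contra h
    have hsub : D' ⊆ C := fun x hx => (hD'C hx).resolve_left fun hxe => h (hxe ▸ hx)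
    have heq := hD'.eq_of_subset_isCircuit hC hsub
    have := hmem f (heq ▸ hfC)
    tauto
  have hinter : ∀ x ∈ D, x ∈ D' → x = e := by
    intro x hx hx'
    rcases hmem x hx' with h | h
    · exact (hDC hx).resolve_right h.2
    · exact absurd hx h.2
  obtain ⟨f', g', hf', hg', hfe', hge', hfg'⟩ := htwo D' hD' heD' hD'C
  rcases hS.total hD.isCyclicFlat_closure hD'.isCyclicFlat_closure with h | h
  · exact hC.not_subset_closure hD' hDC hD'C hinter hf hg hfe hge hfg
      ((M.subset_closure D hD.subset_ground).trans h)
  · exact hC.not_subset_closure hD hD'C hDC (fun x hx hx' => hinter x hx' hx) hf' hg' hfe' hge'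
      hfg' ((M.subset_closure D' hD'.subset_ground).trans h)

theorem IsNonloop.closure_pair {e f : α} (hf : M.IsNonloop f)
    (h : M.closure {e} = M.closure {f}) : M.closure {e, f} = M.closure {f} := by
  refine (M.closure_subset_closure_of_subset_closure ?_).antisymm
    (M.closure_subset_closure (by simp))
  rintro x (rfl | hx)
  · rw [← h]
    refine M.mem_closure_self x ?_
    by_contra hx
    rw [← closure_inter_ground, Set.singleton_inter_eq_empty.2 hx, closure_empty] at h
    exact (not_isNonloop_iff_closure.2 h.symm) hf
  · rw [Set.mem_singleton_iff.1 hx]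
    exact M.mem_closure_self f hf.mem_ground

/-- In a graphic Schubert matroid, at most one element of a circuit has further elements parallel
to it, up to parallelism. -/
theorem IsGraphic.exists_forall_closure_singleton_eq (hM : M.IsGraphic) (hS : M.IsSchubert)
    {C : Set α} (hC : M.IsCircuit C) :
    ∃ f ∈ C, ∀ e ∈ M.closure C, e ∉ C → M.IsNonloop e → M.closure {e} = M.closure {f} := by
  by_cases hall : ∃ e ∈ M.closure C, e ∉ C ∧ M.IsNonloop e
  · obtain ⟨e, he, heC, hel⟩ := hall
    obtain ⟨f, hf, hef⟩ := hM.exists_closure_singleton_eq hS hC he heC hel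
    refine ⟨f, hf, fun e' he' heC' hel' => ?_⟩
    obtain ⟨f', hf', hef'⟩ := hM.exists_closure_singleton_eq hS hC he' heC' hel'
    have hfl : M.IsNonloop f :=
      hel.isNonloop_of_mem_closure (hef ▸ M.mem_closure_self e hel.mem_ground)
    have hfl' : M.IsNonloop f' :=
      hel'.isNonloop_of_mem_closure (hef' ▸ M.mem_closure_self e' hel'.mem_ground)
    have h1 : M.IsCircuit {e, f} := (hel.closure_eq_closure_iff_isCircuit_of_ne (by
      rintro rfl; exact heC hf)).1 hef
    have h2 : M.IsCircuit {e', f'} := (hel'.closure_eq_closure_iff_isCircuit_of_ne (by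
      rintro rfl; exact heC' hf')).1 hef'
    -- These closures are spanned by the single nonloops `f` and `f'`, so being comparable they
    -- coincide.
    have h3 := hS.total h1.isCyclicFlat_closure h2.isCyclicFlat_closure
    rw [hfl.closure_pair hef, hfl'.closure_pair hef'] at h3
    rw [hef']
    rcases h3 with h | h
    · exact (hfl.closure_eq_of_mem_closure (h (M.mem_closure_self f hfl.mem_ground))).symm
    · exact hfl'.closure_eq_of_mem_closure (h (M.mem_closure_self f' hfl'.mem_ground))
  · push Not at hall
    obtain ⟨f, hf⟩ := hC.nonempty
    exact ⟨f, hf, fun e he heC hel => absurd hel (hall e he heC)⟩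

/-- The coloring is normalized: there are path elements if and only if there are parallel
elements. -/
def IsNormalColoring (M : Matroid α) (κ : α → ElementKind) : Prop :=
  M.IsColoring κ ∧ ((∃ e ∈ M.E, κ e = path) ↔ ∃ e ∈ M.E, κ e = parallel)

open Classical in
/-- A matroid all of whose circuits are loops consists of loops and coloops. -/
theorem isNormalColoring_of_forall_isCircuit
    (h : ∀ C, M.IsCircuit C → ¬ C.Nontrivial) :
    M.IsNormalColoring fun e => if M.IsLoop e then loop else coloop := by
  refine ⟨fun I hI => ⟨fun hi => ⟨fun e he => ?_, ?_, ?_⟩, fun hi => ?_⟩, ?_⟩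
  · simp [hi.isNonloop_of_mem he |>.not_isLoop]
  · grind
  · grind
  · by_contra hdep
    obtain ⟨C, hCI, hC⟩ := Dep.exists_isCircuit_subset (M := M) ⟨hdep, hI⟩
    obtain ⟨e, rfl⟩ := (Set.not_nontrivial_iff.1 (h C hC)).eq_empty_or_singleton.resolve_left
      hC.nonempty.ne_empty
    exact hi.1 e (hCI rfl) (if_pos (singleton_isCircuit.1 hC))
  · grind

-- `C` serves as the cycle, and `f` is its edge with parallel copies, itself colored parallel. By
-- `hmax`, elements outside the closure of `C` lie on no nontrivial circuit, hence are loops or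
-- coloops.
open Classical in
theorem isNormalColoring_of_isCircuit {C : Set α} (hC : M.IsCircuit C) (hCn : C.Nontrivial)
    (hmax : ∀ D, M.IsCircuit D → D.Nontrivial → D ⊆ M.closure C) {f : α} (hfC : f ∈ C)
    (hf : ∀ e ∈ M.closure C, e ∉ C → M.IsNonloop e → M.closure {e} = M.closure {f}) :
    M.IsNormalColoring fun e => if M.IsLoop e then loop else if e ∉ M.closure C then coloop else
      if e ∈ C ∧ e ≠ f then path else parallel := by
  set κ : α → ElementKind := fun e => if M.IsLoop e then loop else if e ∉ M.closure C then coloop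
    else if e ∈ C ∧ e ≠ f then path else parallel with hκ
  have hCE := hC.subset_ground
  have hCcl := M.subset_closure C hCE
  have hnl : ∀ e ∈ C, M.IsNonloop e := fun e he => hC.isNonloop_of_mem hCn he
  have hpath : ∀ e, κ e = path ↔ e ∈ C ∧ e ≠ f := by
    intro e
    refine ⟨fun h => ?_, fun h => ?_⟩
    · grind
    · simp only [hκ]
      rw [if_neg (hnl e h.1).not_isLoop, if_neg (not_not.2 (hCcl h.1)), if_pos h]
  have hpar : ∀ e, κ e = parallel → e ∈ M.closure C ∧ M.IsNonloop e ∧ (e ∉ C ∨ e = f) ∧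
      M.closure {e} = M.closure {f} := by
    intro e h
    have h1 : e ∈ M.closure C := by grind
    have h2 : M.IsNonloop e :=
      isNonloop_of_not_isLoop (M.closure_subset_ground C h1) (by grind)
    have h3 : e ∉ C ∨ e = f := by grind
    refine ⟨h1, h2, h3, ?_⟩
    rcases h3 with h3 | rfl
    · exact hf e h1 h3 h2
    · rfl
  have hparf : κ f = parallel := by
    simp only [hκ]
    rw [if_neg (hnl f hfC).not_isLoop, if_neg (not_not.2 (hCcl hfC)), if_neg (by simp)]
  refine ⟨fun I hI => ⟨fun hi => ⟨fun e he => ?_, fun e he e' he' h h' => ?_, fun e he h => ?_⟩,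
    fun hi => ?_⟩, ?_⟩
  · have := (hi.isNonloop_of_mem he).not_isLoop
    grind
  · by_contra hne
    have := ((hpar e h).2.1.closure_eq_closure_iff_isCircuit_of_ne hne).1
      ((hpar e h).2.2.2.trans (hpar e' h').2.2.2.symm)
    exact this.not_indep (hi.subset (Set.insert_subset he (by simpa)))
  · obtain ⟨h1, h2, h3, h4⟩ := hpar e h
    by_contra! hcon
    have hsub : insert e (C \ {f}) ⊆ I := Set.insert_subset he fun p hp =>
      hcon p (hCE hp.1) ((hpath p).2 hp)
    have hnot : e ∉ C \ {f} := by
      rintro ⟨he1, he2⟩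
      exact h3.elim (fun h => h he1) he2
    have hindep := hi.subset hsub
    refine ((hC.sdiff_singleton_indep hfC).insert_indep_iff_of_notMem hnot).1 hindep |>.2 ?_
    rwa [hC.closure_sdiff_singleton_eq]
  · obtain ⟨i1, i2, i3⟩ := hi
    by_contra hdep
    obtain ⟨D, hDI, hD⟩ := Dep.exists_isCircuit_subset (M := M) ⟨hdep, hI⟩
    have hDn : D.Nontrivial := by
      by_contra h
      obtain ⟨e, rfl⟩ := (Set.not_nontrivial_iff.1 h).eq_empty_or_singleton.resolve_left
        hD.nonempty.ne_empty
      exact i1 e (hDI rfl) (if_pos (singleton_isCircuit.1 hD))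
    have hDcl := hmax D hD hDn
    have hcases : ∀ e ∈ D, κ e = path ∨ κ e = parallel := by
      intro e he
      have := (hD.isNonloop_of_mem hDn he).not_isLoop
      have := hDcl he
      grind
    have hex : ∃ q ∈ D, κ q = parallel := by
      by_contra! h
      have hDC : D ⊆ C := fun e he => ((hpath e).1 ((hcases e he).resolve_right (h e he))).1
      have := hD.eq_of_subset_isCircuit hC hDC
      exact h f (this ▸ hfC) hparf
    obtain ⟨q, hq, hκq⟩ := hex
    obtain ⟨p, hpE, hκp, hpI⟩ := i3 q (hDI hq) hκq
    have hpC := (hpath p).1 hκp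
    -- The circuit `D` has the single parallel element `q` and misses the path element `p`. So `q`,
    -- and with it `f`, is spanned by `C` without `p` and `f`, against independence of `C \ {p}`.
    have hsub : D \ {q} ⊆ (C \ {p}) \ {f} := by
      rintro x ⟨hx, hxq⟩
      have hx' := (hpath x).1 ((hcases x hx).resolve_right fun h =>
        hxq (i2 x (hDI hx) q (hDI hq) h hκq))
      refine ⟨⟨hx'.1, ?_⟩, hx'.2⟩
      rintro rfl
      exact hpI (hDI hx)
    have hqcl : q ∈ M.closure ((C \ {p}) \ {f}) :=
      M.closure_subset_closure hsub (hD.mem_closure_sdiff_singleton_of_mem hq)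
    refine (hC.sdiff_singleton_indep hpC.1).notMem_closure_sdiff_of_mem (e := f)
      ⟨hfC, hpC.2.symm⟩ ?_
    have : f ∈ M.closure {q} := by
      rw [(hpar q hκq).2.2.2]
      exact M.mem_closure_self f (hCE hfC)
    exact M.closure_subset_closure_of_subset_closure (by simpa using hqcl) this
  · obtain ⟨p, hp, hpf⟩ := hCn.exists_ne f
    exact iff_of_true ⟨p, hCE hp, (hpath p).2 ⟨hp, hpf⟩⟩ ⟨f, hCE hfC, hparf⟩

theorem IsGraphic.exists_isNormalColoring [M.Finite] (hM : M.IsGraphic) (hS : M.IsSchubert) :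
    ∃ κ, M.IsNormalColoring κ := by
  by_cases h : ∃ C, M.IsCircuit C ∧ C.Nontrivial
  · have hfin : {C | M.IsCircuit C ∧ C.Nontrivial}.Finite :=
      M.ground_finite.finite_subsets.subset fun C hC => hC.1.subset_ground
    -- Closures of circuits form a chain, so the largest closure of a nontrivial circuit contains
    -- every nontrivial circuit.
    obtain ⟨C, ⟨hC, hCn⟩, hmax⟩ := hfin.exists_maximalFor (fun C => (M.closure C).ncard) _ h
    obtain ⟨f, hfC, hf⟩ := hM.exists_forall_closure_singleton_eq hS hC
    refine ⟨_, isNormalColoring_of_isCircuit hC hCn (fun D hD hDn => ?_) hfC hf⟩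
    refine (M.subset_closure D hD.subset_ground).trans ?_
    rcases hS.total hC.isCyclicFlat_closure hD.isCyclicFlat_closure with hle | hle
    · have hDfin : (M.closure D).Finite := M.ground_finite.subset (M.closure_subset_ground D)
      rw [Set.eq_of_subset_of_ncard_le hle (hmax ⟨hD, hDn⟩ (Set.ncard_le_ncard hle hDfin)) hDfin]
    · exact hle
  · push Not at h
    exact ⟨_, isNormalColoring_of_forall_isCircuit fun C hC => by simpa using h C hC⟩

end Matroid

/-! ### Classification up to isomorphism by the numbers of elements of each kind. -/

namespace Matroid

open ElementKind

variable {α β : Type*} {M : Matroid α} {N : Matroid β} {κ : α → ElementKind}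
  {κ' : β → ElementKind}

/-- A coloring expressed through sets of elements of the subtype `M.E`. -/
theorem isColoring_iff : M.IsColoring κ ↔ ∀ I : Set M.E, M.Indep (Subtype.val '' I) ↔
    (∀ e ∈ I, κ e ≠ loop) ∧
    (∀ e ∈ I, ∀ f ∈ I, κ e = parallel → κ f = parallel → e = f) ∧
    (∀ e ∈ I, κ e = parallel → ∃ p : M.E, κ p = path ∧ p ∉ I) := by
  have key : ∀ I : Set M.E, ((∀ e ∈ Subtype.val '' I, κ e ≠ loop) ∧
      (∀ e ∈ Subtype.val '' I, ∀ f ∈ Subtype.val '' I,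
        κ e = parallel → κ f = parallel → e = f) ∧
      (∀ e ∈ Subtype.val '' I, κ e = parallel → ∃ p ∈ M.E, κ p = path ∧ p ∉ Subtype.val '' I)) ↔
      (∀ e ∈ I, κ e ≠ loop) ∧
      (∀ e ∈ I, ∀ f ∈ I, κ e = parallel → κ f = parallel → e = f) ∧
      (∀ e ∈ I, κ e = parallel → ∃ p : M.E, κ p = path ∧ p ∉ I) := by
    intro I
    refine and_congr Set.forall_mem_image (and_congr ?_ ⟨?_, ?_⟩)
    · simp only [Set.forall_mem_image, Subtype.ext_iff]
    · intro h e he hκ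
      obtain ⟨p, hp, hκp, hpI⟩ := h e ⟨e, he, rfl⟩ hκ
      exact ⟨⟨p, hp⟩, hκp, fun h => hpI ⟨_, h, rfl⟩⟩
    · rintro h _ ⟨e, he, rfl⟩ hκ
      obtain ⟨p, hκp, hpI⟩ := h e he hκ
      exact ⟨p, p.2, hκp, fun ⟨q, hq, hqp⟩ => hpI (Subtype.ext hqp ▸ hq)⟩
  constructor
  · intro h I
    rw [h _ (by simp), key]
  · intro h I hI
    obtain ⟨J, rfl⟩ : ∃ J : Set M.E, I = Subtype.val '' J :=
      ⟨Subtype.val ⁻¹' I, by simp [Set.inter_eq_self_of_subset_right hI]⟩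
    rw [h, key]

theorem IsColoring.indep_image_equiv_iff (h' : N.IsColoring κ') (e : M.E ≃ N.E)
    (he : ∀ x, κ' (e x) = κ x) (I : Set M.E) : N.Indep (Subtype.val '' (e '' I)) ↔
      (∀ e ∈ I, κ e ≠ loop) ∧
      (∀ e ∈ I, ∀ f ∈ I, κ e = parallel → κ f = parallel → e = f) ∧
      (∀ e ∈ I, κ e = parallel → ∃ p : M.E, κ p = path ∧ p ∉ I) := by
  have hex : (∃ p : N.E, κ' p = path ∧ p ∉ e '' I) ↔ ∃ p : M.E, κ p = path ∧ p ∉ I := by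
    rw [← e.exists_congr_right]
    simp only [he, e.injective.mem_set_image]
  rw [isColoring_iff.1 h']
  simp only [Set.forall_mem_image, he, e.injective.eq_iff, hex]

theorem IsColoring.of_isIso (h' : N.IsColoring κ') (hiso : M.IsIso N) :
    ∃ κ, M.IsColoring κ := by
  classical
  obtain ⟨e, he⟩ := hiso
  set κ : α → ElementKind := fun x => if h : x ∈ M.E then κ' (e ⟨x, h⟩) else loop with hκ
  refine ⟨κ, isColoring_iff.2 fun I => ?_⟩
  rw [he, h'.indep_image_equiv_iff e (κ := κ) fun x => by simp [hκ]]

/-- The number of elements of a given kind. -/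
noncomputable def kindCard (M : Matroid α) (κ : α → ElementKind) (t : ElementKind) : ℕ :=
  {e ∈ M.E | κ e = t}.ncard

theorem natCard_subtype_kind (M : Matroid α) (κ : α → ElementKind) (t : ElementKind) :
    Nat.card {x : M.E // κ x = t} = M.kindCard κ t := by
  rw [kindCard, ← Nat.card_coe_set_eq]
  exact Nat.card_congr (Equiv.subtypeSubtypeEquivSubtypeInter (· ∈ M.E) fun x => κ x = t)

/-- Independence depends on the colors only, so any color-preserving bijection is an isomorphism. -/
theorem IsColoring.isIso [M.Finite] [N.Finite] (h : M.IsColoring κ) (h' : N.IsColoring κ')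
    (hcard : ∀ t, M.kindCard κ t = N.kindCard κ' t) : M.IsIso N := by
  have hM := M.ground_finite.to_subtype
  have hN := N.ground_finite.to_subtype
  have hequiv : ∀ t, Nonempty ({x : M.E // κ x = t} ≃ {x : N.E // κ' x = t}) := by
    intro t
    rw [← Finite.card_eq, M.natCard_subtype_kind, N.natCard_subtype_kind]
    exact hcard t
  have g := fun t => (hequiv t).some
  let e : M.E ≃ N.E := (Equiv.sigmaFiberEquiv fun x : M.E => κ x).symm.trans
    ((Equiv.sigmaCongrRight g).trans (Equiv.sigmaFiberEquiv fun x : N.E => κ' x))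
  have he : ∀ x, κ' (e x) = κ x := fun x => (g (κ x) ⟨x, rfl⟩).2
  exact ⟨e, fun I => by rw [h'.indep_image_equiv_iff e he, isColoring_iff.1 h]⟩

theorem sum_kindCard [M.Finite] (κ : α → ElementKind) :
    M.kindCard κ loop + M.kindCard κ path + M.kindCard κ parallel + M.kindCard κ coloop
      = M.E.ncard := by
  classical
  have hfin := M.ground_finite
  have h1 : ∀ t, M.kindCard κ t = (hfin.toFinset.filter fun e => κ e = t).card := by
    intro t
    rw [kindCard, ← Set.ncard_coe_finset]
    congr 1
    ext x
    simp
  have h2 := Finset.card_eq_sum_card_fiberwise (f := κ) (s := hfin.toFinset)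
    (t := {loop, path, parallel, coloop}) fun e _ => by
      show κ e ∈ (({loop, path, parallel, coloop} : Finset ElementKind) : Set ElementKind)
      cases κ e <;> simp
  rw [← Set.ncard_eq_toFinset_card _ hfin] at h2
  rw [h2]
  simp only [h1]
  rw [Finset.sum_insert (by simp), Finset.sum_insert (by simp), Finset.sum_pair (by simp)]
  omega

/-- Without parallel elements the clauses hold trivially. A further element is a loop, or a parallel
element that completes the path to a dependent set. -/
theorem IsColoring.isBase (h : M.IsColoring κ) :
    M.IsBase {e ∈ M.E | κ e = path ∨ κ e = coloop} := by
  have hsub : {e ∈ M.E | κ e = path ∨ κ e = coloop} ⊆ M.E := Set.sep_subset _ _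
  have hi : M.Indep {e ∈ M.E | κ e = path ∨ κ e = coloop} :=
    (h _ hsub).2 ⟨by grind, by grind, by grind⟩
  refine hi.isBase_of_forall_insert fun e he hind => ?_
  obtain ⟨h1, -, h3⟩ := (h _ (Set.insert_subset he.1 hsub)).1 hind
  have h4 := h1 e (by simp)
  have h5 : κ e = parallel := by
    cases hκ : κ e with
    | loop => exact absurd hκ h4
    | path => exact absurd ⟨he.1, Or.inl hκ⟩ he.2
    | parallel => rfl
    | coloop => exact absurd ⟨he.1, Or.inr hκ⟩ he.2
  obtain ⟨p, hp, hκp, hpn⟩ := h3 e (by simp) h5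
  exact hpn (Or.inr ⟨hp, Or.inl hκp⟩)

theorem IsColoring.kindCard_path_add_kindCard_coloop [M.Finite] (h : M.IsColoring κ) {k : ℕ}
    (hk : M.eRank = k) : M.kindCard κ path + M.kindCard κ coloop = k := by
  have h1 := h.isBase.encard_eq_eRank
  have hfin := M.ground_finite
  rw [← (hfin.subset (Set.sep_subset _ _)).cast_ncard_eq, hk] at h1
  have h2 : {e ∈ M.E | κ e = path ∨ κ e = coloop}
      = {e ∈ M.E | κ e = path} ∪ {e ∈ M.E | κ e = coloop} := by
    ext x; simp only [Set.mem_union, Set.mem_ofPred_eq]; tauto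
  rw [h2, Set.ncard_union_eq (by
    rw [Set.disjoint_left]
    rintro x ⟨-, hx⟩ ⟨-, hx'⟩
    simp [hx] at hx') (hfin.subset (Set.sep_subset _ _)) (hfin.subset (Set.sep_subset _ _))] at h1
  exact_mod_cast h1

theorem ncard_setOf_val_lt {k n : ℕ} (h : k ≤ n) : {i : Fin n | (i : ℕ) < k}.ncard = k := by
  have : {i : Fin n | (i : ℕ) < k} = Set.range (Fin.castLE h) := by
    ext i
    exact ⟨fun hi => ⟨⟨i, hi⟩, rfl⟩, by rintro ⟨j, rfl⟩; exact j.2⟩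
  rw [this, ← Set.image_univ, Set.ncard_image_of_injective _ (Fin.castLE_injective h)]
  simp

theorem minimalMatroid_ground {k n : ℕ} (h : k ≤ n) : (minimalMatroid k n h).E = Set.univ := rfl

/-- The base to extend to is the initial segment, or the segment with a missing `p` exchanged for
the one late element `q` of `I`. -/
theorem minimalMatroid_indep_iff {k n : ℕ} (h : k ≤ n) (I : Set (Fin n)) :
    (minimalMatroid k n h).Indep I ↔
      (∀ e ∈ I, ∀ f ∈ I, k ≤ (e : ℕ) → k ≤ (f : ℕ) → e = f) ∧
      ∀ e ∈ I, k ≤ (e : ℕ) → ∃ p : Fin n, (p : ℕ) < k ∧ p ∉ I := by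
  have hbase : ∀ B, (minimalMatroid k n h).IsBase B ↔
      B.ncard = k ∧ k ≤ (B ∩ {i : Fin n | (i : ℕ) < k}).ncard + 1 := fun _ => Iff.rfl
  have hS := ncard_setOf_val_lt h
  rw [indep_iff]
  simp only [hbase]
  set S := {i : Fin n | (i : ℕ) < k} with hSdef
  have hmemS : ∀ i : Fin n, i ∈ S ↔ (i : ℕ) < k := fun i => Iff.rfl
  constructor
  · rintro ⟨B, ⟨hB, hBS⟩, hIB⟩
    have hsum := Set.ncard_inter_add_ncard_sdiff_eq_ncard B S
    refine ⟨fun e he f hf hek hfk => ?_, fun e he hek => ?_⟩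
    · refine (Set.ncard_le_one (Set.toFinite (B \ S))).1 (by omega) e ⟨hIB he, ?_⟩ f ⟨hIB hf, ?_⟩
      · rw [hmemS]; omega
      · rw [hmemS]; omega
    · by_contra! hcon
      have hle : S.ncard ≤ (B ∩ S).ncard :=
        Set.ncard_le_ncard fun p hp => ⟨hIB (hcon p hp), hp⟩
      have hpos : 0 < (B \ S).ncard :=
        (Set.ncard_pos).2 ⟨e, hIB he, by rw [hmemS]; omega⟩
      omega
  · rintro ⟨h1, h2⟩
    by_cases hq : ∃ q ∈ I, k ≤ (q : ℕ)
    · obtain ⟨q, hqI, hqk⟩ := hq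
      obtain ⟨p, hpk, hpI⟩ := h2 q hqI hqk
      have hqS : q ∉ S := by rw [hmemS]; omega
      have hc := Set.ncard_sdiff_singleton_add_one (s := S) (a := p) hpk
      refine ⟨insert q (S \ {p}), ⟨?_, ?_⟩, fun x hx => ?_⟩
      · rw [Set.ncard_insert_of_notMem fun hh => hqS hh.1]
        omega
      · have : (S \ {p}).ncard ≤ (insert q (S \ {p}) ∩ S).ncard :=
          Set.ncard_le_ncard fun x hx => ⟨Or.inr hx, hx.1⟩
        omega
      · by_cases hxk : k ≤ (x : ℕ)
        · exact Or.inl (h1 x hx q hqI hxk hqk)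
        · refine Or.inr ⟨?_, ?_⟩
          · rw [hmemS]; omega
          · rintro rfl; exact hpI hx
    · push Not at hq
      exact ⟨S, ⟨hS, by rw [Set.inter_self]; omega⟩, fun x hx => hq x hx⟩

/-- The kinds of the elements of `minimalWithLoopsColoops m a b l h`. -/
def standardKind (m a b l : ℕ) : Fin m ⊕ (Fin b ⊕ Fin l) → ElementKind
  | .inl _ => loop
  | .inr (.inl i) => if (i : ℕ) < a then path else parallel
  | .inr (.inr _) => coloop

theorem minimalWithLoopsColoops_ground {m a b l : ℕ} (h : a ≤ b) :
    (minimalWithLoopsColoops m a b l h).E = Set.univ := by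
  ext x
  rcases x with x | x | x <;> simp [minimalWithLoopsColoops, minimalMatroid_ground]

instance {m a b l : ℕ} (h : a ≤ b) : (minimalWithLoopsColoops m a b l h).Finite :=
  ⟨Set.toFinite _⟩

theorem isColoring_minimalWithLoopsColoops {m a b l : ℕ} (h : a ≤ b) :
    (minimalWithLoopsColoops m a b l h).IsColoring (standardKind m a b l) := by
  intro I _
  simp only [minimalWithLoopsColoops_ground, Set.mem_univ, true_and]
  simp only [minimalWithLoopsColoops, sum_indep_iff, loopyOn_indep_iff, freeOn_indep_iff,
    Set.subset_univ, and_true, minimalMatroid_indep_iff, Set.eq_empty_iff_forall_notMem,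
    Set.mem_preimage]
  have hpar : ∀ i : Fin b, standardKind m a b l (.inr (.inl i)) = parallel ↔ a ≤ (i : ℕ) := by
    intro i
    simp [standardKind]
  have hpath : ∀ i : Fin b, standardKind m a b l (.inr (.inl i)) = path ↔ (i : ℕ) < a := by
    intro i
    simp [standardKind]
  refine ⟨fun ⟨h1, h2, h3⟩ => ⟨?_, ?_, ?_⟩, fun ⟨h1, h2, h3⟩ => ⟨?_, ?_, ?_⟩⟩
  · rintro (x | x | x) hx
    · exact absurd hx (h1 x)
    · simp only [standardKind]
      split_ifs <;> simp
    · simp [standardKind]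
  · rintro (x | x | x) hx (y | y | y) hy hκx hκy
    all_goals first
      | exact congrArg (Sum.inr ∘ Sum.inl) (h2 x hx y hy ((hpar x).1 hκx) ((hpar y).1 hκy))
      | simp [standardKind] at hκx hκy
  · rintro (x | x | x) hx hκx
    · simp [standardKind] at hκx
    · obtain ⟨p, hp, hpI⟩ := h3 x hx ((hpar x).1 hκx)
      exact ⟨.inr (.inl p), (hpath p).2 hp, hpI⟩
    · simp [standardKind] at hκx
  · exact fun x hx => h1 _ hx rfl
  · intro x hx y hy hxa hya
    simpa using h2 _ hx _ hy ((hpar x).2 hxa) ((hpar y).2 hya)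
  · intro x hx hxa
    obtain ⟨p | p | p, hp, hpI⟩ := h3 _ hx ((hpar x).2 hxa)
    · simp [standardKind] at hp
    · exact ⟨p, (hpath p).1 hp, hpI⟩
    · simp [standardKind] at hp

theorem kindCard_standardKind {m a b l : ℕ} (h : a ≤ b) :
    (minimalWithLoopsColoops m a b l h).kindCard (standardKind m a b l) loop = m ∧
    (minimalWithLoopsColoops m a b l h).kindCard (standardKind m a b l) path = a ∧
    (minimalWithLoopsColoops m a b l h).kindCard (standardKind m a b l) parallel = b - a ∧
    (minimalWithLoopsColoops m a b l h).kindCard (standardKind m a b l) coloop = l := by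
  have h1 : (minimalWithLoopsColoops m a b l h).kindCard (standardKind m a b l) loop = m := by
    have : {e ∈ (minimalWithLoopsColoops m a b l h).E | standardKind m a b l e = loop}
        = Sum.inl '' Set.univ := by
      rw [minimalWithLoopsColoops_ground]
      ext x
      rcases x with x | x | x <;> simp [standardKind]
      split_ifs <;> simp
    rw [kindCard, this, Set.ncard_image_of_injective _ Sum.inl_injective]
    simp
  have h2 : (minimalWithLoopsColoops m a b l h).kindCard (standardKind m a b l) path = a := by
    have : {e ∈ (minimalWithLoopsColoops m a b l h).E | standardKind m a b l e = path}
        = (Sum.inr ∘ Sum.inl) '' {i : Fin b | (i : ℕ) < a} := by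
      rw [minimalWithLoopsColoops_ground]
      ext x
      rcases x with x | x | x <;> simp [standardKind]
    rw [kindCard, this, Set.ncard_image_of_injective _ (Sum.inr_injective.comp Sum.inl_injective),
      ncard_setOf_val_lt h]
  have h4 : (minimalWithLoopsColoops m a b l h).kindCard (standardKind m a b l) coloop = l := by
    have : {e ∈ (minimalWithLoopsColoops m a b l h).E | standardKind m a b l e = coloop}
        = (Sum.inr ∘ Sum.inr) '' Set.univ := by
      rw [minimalWithLoopsColoops_ground]
      ext x
      rcases x with x | x | x <;> simp [standardKind]
      split_ifs <;> simp
    rw [kindCard, this, Set.ncard_image_of_injective _ (Sum.inr_injective.comp Sum.inr_injective)]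
    simp
  have h5 := sum_kindCard (M := minimalWithLoopsColoops m a b l h) (standardKind m a b l)
  have h6 : (minimalWithLoopsColoops m a b l h).E.ncard = m + (b + l) := by
    rw [minimalWithLoopsColoops_ground, Set.ncard_univ]
    simp
  exact ⟨h1, h2, by omega, h4⟩

theorem isGraphic_and_isSchubert_iff (M : Matroid α) [M.Finite] {n k : ℕ} (hn : M.E.ncard = n)
    (hk : M.eRank = k) : M.IsGraphic ∧ M.IsSchubert ↔
      ∃ (m l a b : ℕ) (h : a ≤ b), a + l = k ∧ m + b + l = n ∧
        M.IsIso (minimalWithLoopsColoops m a b l h) := by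
  constructor
  · rintro ⟨hM, hS⟩
    obtain ⟨κ, hκ, -⟩ := hM.exists_isNormalColoring hS
    have hsum := sum_kindCard (M := M) κ
    refine ⟨M.kindCard κ loop, M.kindCard κ coloop, M.kindCard κ path,
      M.kindCard κ path + M.kindCard κ parallel, by omega,
      hκ.kindCard_path_add_kindCard_coloop hk, by omega,
      hκ.isIso (isColoring_minimalWithLoopsColoops _) ?_⟩
    obtain ⟨h1, h2, h3, h4⟩ := kindCard_standardKind (m := M.kindCard κ loop)
      (a := M.kindCard κ path) (b := M.kindCard κ path + M.kindCard κ parallel)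
      (l := M.kindCard κ coloop) (by omega)
    rintro (_ | _ | _ | _)
    · exact h1.symm
    · exact h2.symm
    · rw [h3]; omega
    · exact h4.symm
  · rintro ⟨m, l, a, b, h, -, -, hiso⟩
    obtain ⟨κ, hκ⟩ := (isColoring_minimalWithLoopsColoops h).of_isIso hiso
    exact ⟨hκ.isGraphic, hκ.isSchubert⟩

end Matroid

/-! ### Tutte polynomials compared with x^k y^(n-k). -/

namespace Matroid

open ElementKind MvPolynomial

variable {α : Type*} {M : Matroid α}

theorem coe_toNat_eRk (M : Matroid α) (A : Finset α) : (((M.eRk A).toNat : ℕ) : ℕ∞) = M.eRk A :=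
  ENat.natCast_toNat (((M.eRk_le_encard A).trans_lt (by simp)).ne)

theorem toNat_eRk_le_card (M : Matroid α) (A : Finset α) : (M.eRk A).toNat ≤ A.card := by
  have := M.eRk_le_encard A
  rw [← coe_toNat_eRk, Set.encard_coe_eq_coe_finsetCard] at this
  exact_mod_cast this

theorem toNat_eRk_le {k : ℕ} (hk : M.eRank = k) (A : Finset α) : (M.eRk A).toNat ≤ k := by
  have := M.eRk_le_eRank A
  rw [← coe_toNat_eRk, hk] at this
  exact_mod_cast this

theorem IsBase.card_eq {k : ℕ} (hk : M.eRank = k) {B : Finset α} (hB : M.IsBase B) :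
    B.card = k := by
  have := hB.encard_eq_eRank
  rw [hk, Set.encard_coe_eq_coe_finsetCard] at this
  exact_mod_cast this

open Classical in
theorem IsBase.card_inter_le {B : Finset α} (hB : M.IsBase B) (A : Finset α) :
    (A ∩ B).card ≤ (M.eRk A).toNat := by
  have hi : M.Indep (A ∩ B : Finset α) := hB.indep.subset (by simp)
  have := hi.encard_le_eRk_of_subset (X := (A : Set α)) (by simp)
  rw [← coe_toNat_eRk, Set.encard_coe_eq_coe_finsetCard] at this
  exact_mod_cast this

-- Expand the product over `E` whose factor is `1 + u` on `B` and `1 + v` off `B`; `A` records the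
-- elements where the first summand is chosen.
open Classical in
theorem sum_powerset_pow_mul_pow {R : Type*} [CommRing R] (E B : Finset α) (hBE : B ⊆ E)
    (u v : R) : ∑ A ∈ E.powerset, u ^ (B \ A).card * v ^ (A \ B).card
      = (1 + u) ^ B.card * (1 + v) ^ (E.card - B.card) := by
  have h1 := Finset.prod_add (fun e => if e ∈ B then 1 else v) (fun e => if e ∈ B then u else 1) E
  have h2 : ∏ e ∈ E, ((if e ∈ B then 1 else v) + (if e ∈ B then u else 1))
      = (1 + u) ^ B.card * (1 + v) ^ (E.card - B.card) := by
    rw [← Finset.prod_sdiff hBE, ← Finset.card_sdiff_of_subset hBE, mul_comm]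
    congr 1
    · rw [← Finset.prod_const]
      exact Finset.prod_congr rfl fun e he => by simp [he]
    · rw [← Finset.prod_const]
      exact Finset.prod_congr rfl fun e he => by simp [(Finset.mem_sdiff.1 he).2, add_comm]
  rw [← h2, h1]
  refine Finset.sum_congr rfl fun A hA => ?_
  have hAE := Finset.mem_powerset.1 hA
  rw [mul_comm, Finset.prod_ite, Finset.prod_ite]
  simp only [Finset.prod_const_one, one_mul, mul_one, Finset.prod_const]
  congr 3
  · ext x; simp
  · ext x
    simp only [Finset.mem_sdiff, Finset.mem_filter]
    exact ⟨fun h => ⟨⟨hBE h.1, h.2⟩, h.1⟩, fun h => ⟨h.2, h.1.2⟩⟩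

open Classical in
/-- Comparison of the rank generating function of a matroid with that of a matroid consisting of
the coloops `B` and loops. -/
theorem IsBase.pow_mul_pow_mul_pow {R : Type*} [CommRing R] (u v : R) {k : ℕ} (hk : M.eRank = k)
    {B : Finset α} (hB : M.IsBase B) (A : Finset α) :
    u ^ (k - (M.eRk A).toNat) * v ^ (A.card - (M.eRk A).toNat) *
      (u * v) ^ ((M.eRk A).toNat - (A ∩ B).card) = u ^ (B \ A).card * v ^ (A \ B).card := by
  have h1 := toNat_eRk_le hk A
  have h2 := M.toNat_eRk_le_card A
  have h3 := hB.card_inter_le A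
  have h4 := hB.card_eq hk
  have h5 := Finset.card_sdiff_add_card_inter A B
  have h6 := Finset.card_sdiff_add_card_inter B A
  rw [Finset.inter_comm] at h6
  have h7 : (B \ A).card = (k - (M.eRk A).toNat) + ((M.eRk A).toNat - (A ∩ B).card) := by omega
  have h8 : (A \ B).card = (A.card - (M.eRk A).toNat) + ((M.eRk A).toNat - (A ∩ B).card) := by
    omega
  rw [h7, h8, pow_add, pow_add, mul_pow]
  ring

theorem tutte_eq_sum [M.Finite] {k : ℕ} (hk : M.eRank = k) :
    M.tutte = ∑ A ∈ M.ground_finite.toFinset.powerset,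
      (X 0 - 1) ^ (k - (M.eRk (A : Set α)).toNat) *
        (X 1 - 1) ^ (A.card - (M.eRk (A : Set α)).toNat) := by
  rw [tutte, hk]
  rfl

theorem exists_finset_isBase (M : Matroid α) [M.Finite] :
    ∃ B : Finset α, M.IsBase B ∧ B ⊆ M.ground_finite.toFinset := by
  obtain ⟨B, hB⟩ := M.exists_isBase
  obtain ⟨B, rfl⟩ := (M.ground_finite.subset hB.subset_ground).exists_finset_coe
  exact ⟨B, hB, fun x hx => by simpa using hB.subset_ground hx⟩

theorem pow_mul_pow_eq_sum [M.Finite] {n k : ℕ} (hn : M.E.ncard = n) (hk : M.eRank = k)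
    {B : Finset α} (hB : M.IsBase B) [DecidableEq α] :
    (X 0 ^ k * X 1 ^ (n - k) : MvPolynomial (Fin 2) ℤ)
      = ∑ A ∈ M.ground_finite.toFinset.powerset,
        (X 0 - 1) ^ (B \ A).card * (X 1 - 1) ^ (A \ B).card := by
  have h1 := sum_powerset_pow_mul_pow M.ground_finite.toFinset B
    (fun x hx => by simpa using hB.subset_ground hx) (X 0 - 1 : MvPolynomial (Fin 2) ℤ) (X 1 - 1)
  rw [hB.card_eq hk, ← Set.ncard_eq_toFinset_card _ M.ground_finite, hn, add_sub_cancel,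
    add_sub_cancel] at h1
  rw [← h1]
  exact Finset.sum_congr rfl fun A _ => by congr!

/-- The Tutte polynomial of a matroid agrees with that of a matroid consisting of loops and coloops
up to a multiple of `(x - 1) * (y - 1) - 1` of bounded degree. -/
theorem sub_tutte_mem [M.Finite] {n k : ℕ} (hn : M.E.ncard = n) (hk : M.eRank = k)
    (S : Submodule ℤ (MvPolynomial (Fin 2) ℤ))
    (hS : ∀ i < k, ∀ j < n - k, ((X 0 - 1) * (X 1 - 1) - 1) * ((X 0 - 1) ^ i * (X 1 - 1) ^ j) ∈ S) :
    X 0 ^ k * X 1 ^ (n - k) - M.tutte ∈ S := by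
  classical
  obtain ⟨B, hB, hBE⟩ := M.exists_finset_isBase
  rw [pow_mul_pow_eq_sum hn hk hB, tutte_eq_sum hk, ← Finset.sum_sub_distrib]
  refine S.sum_mem fun A hA => ?_
  have hAE := Finset.mem_powerset.1 hA
  have h1 := toNat_eRk_le hk A
  have h2 := M.toNat_eRk_le_card A
  have h3 := hB.card_inter_le A
  have h4 := hB.card_eq hk
  have h5 := Finset.card_sdiff_add_card_inter A B
  have h6 : (A ∪ B).card ≤ n := by
    rw [← hn, Set.ncard_eq_toFinset_card _ M.ground_finite]
    exact Finset.card_le_card (Finset.union_subset hAE hBE)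
  have h7 := Finset.card_sdiff_add_card A B
  have key := hB.pow_mul_pow_mul_pow (X 0 - 1 : MvPolynomial (Fin 2) ℤ) (X 1 - 1) hk A
  -- The difference of the summands of `A` is the Tutte summand times (uv)^d - 1, and the geometric
  -- sum extracts the factor uv - 1.
  have h8 := geom_sum_mul ((X 0 - 1) * (X 1 - 1) : MvPolynomial (Fin 2) ℤ)
    ((M.eRk A).toNat - (A ∩ B).card)
  rw [← key, ← mul_sub_one, ← h8, Finset.sum_mul, Finset.mul_sum]
  refine S.sum_mem fun s hs => ?_
  have hs' := Finset.mem_range.1 hs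
  -- Since s < d, the exponents stay below k - |A ∩ B| ≤ k and |A \ B| ≤ n - k, the latter because
  -- |A ∪ B| ≤ n.
  convert hS (k - (M.eRk A).toNat + s) (by omega) (A.card - (M.eRk A).toNat + s) (by omega) using 1
  rw [mul_pow, pow_add, pow_add]
  ring

namespace IsColoring

variable {κ : α → ElementKind}

-- `A ∩ B` is a basis of `A` unless a parallel element can be added, which requires `A` to miss a
-- path element; a second one can never be added. So d is 0 or 1.
open Classical in
theorem toNat_eRk_eq (h : M.IsColoring κ) {A B : Finset α} (hA : (A : Set α) ⊆ M.E)
    (hB : (B : Set α) = {e ∈ M.E | κ e = path ∨ κ e = coloop}) :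
    (M.eRk A).toNat = (A ∩ B).card +
      if (∃ q ∈ A, κ q = parallel) ∧ ∃ p ∈ M.E, κ p = path ∧ p ∉ A then 1 else 0 := by
  have hBmem : ∀ e, e ∈ B ↔ e ∈ M.E ∧ (κ e = path ∨ κ e = coloop) := fun e => by
    rw [← Finset.mem_coe, hB]; rfl
  have key : ∀ I : Finset α, I ⊆ A → M.Indep I → (∀ e ∈ A, e ∉ I → ¬ M.Indep (insert e I)) →
      (M.eRk A).toNat = I.card := by
    intro I hIA hI hmax
    have : M.IsBasis I A := hI.isBasis_of_forall_insert (by simpa using hIA) fun e he =>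
      ⟨hmax e he.1 (by simpa using he.2),
        Set.insert_subset (hA he.1) ((Finset.coe_subset.2 hIA).trans hA)⟩
    rw [this.eRk_eq_encard, Set.encard_coe_eq_coe_finsetCard, ENat.toNat_natCast]
  split_ifs with ht
  · obtain ⟨⟨q, hq, hκq⟩, p, hp, hκp, hpA⟩ := ht
    have hqB : q ∉ B := by rw [hBmem]; simp [hκq]
    have hsub : insert q (A ∩ B) ⊆ A :=
      Finset.insert_subset hq Finset.inter_subset_left
    have hsub' : ((insert q (A ∩ B) : Finset α) : Set α) ⊆ M.E := (Finset.coe_subset.2 hsub).trans hA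
    rw [← Finset.card_insert_of_notMem (s := A ∩ B) (a := q) (by simp [hqB])]
    refine key _ hsub ((h _ hsub').2 ⟨?_, ?_, ?_⟩) ?_
    · intro e he
      simp only [Finset.coe_insert, Finset.coe_inter, Set.mem_insert_iff, Set.mem_inter_iff,
        Finset.mem_coe, hBmem] at he
      grind
    · intro e he f hf
      simp only [Finset.coe_insert, Finset.coe_inter, Set.mem_insert_iff, Set.mem_inter_iff,
        Finset.mem_coe, hBmem] at he hf
      grind
    · exact fun e _ _ => ⟨p, hp, hκp, fun hh => hpA (hsub hh)⟩
    · intro e he heI hind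
      obtain ⟨h1, h2, -⟩ := (h _ (Set.insert_subset (hA he) hsub')).1 hind
      have heq : e ≠ q := by
        rintro rfl
        simp at heI
      have heB : e ∉ B := fun hh => heI (by simp [he, hh])
      cases hκ : κ e with
      | loop => exact h1 e (by simp) hκ
      | path => exact heB ((hBmem e).2 ⟨hA he, Or.inl hκ⟩)
      | parallel => exact heq (h2 e (by simp) q (by simp) hκ hκq)
      | coloop => exact heB ((hBmem e).2 ⟨hA he, Or.inr hκ⟩)
  · have hsub' : ((A ∩ B : Finset α) : Set α) ⊆ M.E :=
      (Finset.coe_subset.2 Finset.inter_subset_left).trans hA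
    refine key _ Finset.inter_subset_left ((h _ hsub').2 ⟨?_, ?_, ?_⟩) ?_
    · intro e he
      simp only [Finset.coe_inter, Set.mem_inter_iff, Finset.mem_coe, hBmem] at he
      grind
    · intro e he
      simp only [Finset.coe_inter, Set.mem_inter_iff, Finset.mem_coe, hBmem] at he
      grind
    · intro e he
      simp only [Finset.coe_inter, Set.mem_inter_iff, Finset.mem_coe, hBmem] at he
      grind
    · intro e he heI hind
      obtain ⟨h1, -, h3⟩ := (h _ (Set.insert_subset (hA he) hsub')).1 hind
      have heB : e ∉ B := fun hh => heI (by simp [he, hh])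
      cases hκ : κ e with
      | loop => exact h1 e (by simp) hκ
      | path => exact heB ((hBmem e).2 ⟨hA he, Or.inl hκ⟩)
      | parallel =>
        obtain ⟨p, hp, hκp, hpI⟩ := h3 e (by simp) hκ
        refine ht ⟨⟨e, he, hκ⟩, p, hp, hκp, fun hpA => hpI (Or.inr ?_)⟩
        simp [hpA, hBmem, hp, hκp]
      | coloop => exact heB ((hBmem e).2 ⟨hA he, Or.inr hκ⟩)

end IsColoring

theorem prod_kind [M.Finite] {R : Type*} [CommMonoid R] (κ : α → ElementKind)
    (g : ElementKind → R) : ∏ e ∈ M.ground_finite.toFinset, g (κ e)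
      = g loop ^ M.kindCard κ loop * (g path ^ M.kindCard κ path *
        (g parallel ^ M.kindCard κ parallel * g coloop ^ M.kindCard κ coloop)) := by
  classical
  have hfin := M.ground_finite
  have h1 : ∀ t, M.kindCard κ t = (hfin.toFinset.filter fun e => κ e = t).card := by
    intro t
    rw [kindCard, ← Set.ncard_coe_finset]
    congr 1
    ext x
    simp
  rw [← Finset.prod_fiberwise_of_maps_to' (g := κ) (t := {loop, path, parallel, coloop}) fun e _ => by
      cases κ e <;> simp]
  simp only [h1, Finset.prod_const]
  rw [Finset.prod_insert (by simp), Finset.prod_insert (by simp), Finset.prod_pair (by simp)]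

/-- Sum over the sets which contain a parallel element but not all path elements. -/
theorem sum_filter_parallel_path [M.Finite] {R : Type*} [CommRing R] (κ : α → ElementKind)
    (u v : R) [DecidableEq α] {B : Finset α}
    (hB : (B : Set α) = {e ∈ M.E | κ e = path ∨ κ e = coloop})
    [DecidablePred fun A : Finset α =>
      (∃ q ∈ A, κ q = parallel) ∧ ∃ p ∈ M.E, κ p = path ∧ p ∉ A] :
    ∑ A ∈ M.ground_finite.toFinset.powerset,
      (if (∃ q ∈ A, κ q = parallel) ∧ ∃ p ∈ M.E, κ p = path ∧ p ∉ A then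
        u ^ (B \ A).card * v ^ (A \ B).card else 0)
      = (1 + v) ^ M.kindCard κ loop * (1 + u) ^ M.kindCard κ coloop *
        (((1 + u) ^ M.kindCard κ path - 1) * ((1 + v) ^ M.kindCard κ parallel - 1)) := by
  have hBmem : ∀ e, e ∈ B ↔ e ∈ M.E ∧ (κ e = path ∨ κ e = coloop) := fun e => by
    rw [← Finset.mem_coe, hB]; rfl
  set E := M.ground_finite.toFinset with hE
  have hEmem : ∀ e, e ∈ E ↔ e ∈ M.E := by simp [hE]
  -- `f s` weights elements of `A`, with `s` on parallel ones; `g t` weights elements outside `A`,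
  -- with `t` on path ones. Subtracting the values at `s = 0` and `t = 0` removes the sets without a
  -- parallel element and those containing the whole path.
  let f : R → ElementKind → R := fun s t => match t with
    | loop => v | path => 1 | parallel => s | coloop => 1
  let g : R → ElementKind → R := fun s t => match t with
    | loop => 1 | path => s | parallel => 1 | coloop => u
  have hfg : ∀ s t, ∑ A ∈ E.powerset, (∏ e ∈ A, f s (κ e)) * ∏ e ∈ E \ A, g t (κ e)
      = (1 + v) ^ M.kindCard κ loop * ((1 + t) ^ M.kindCard κ path *
        ((1 + s) ^ M.kindCard κ parallel * (1 + u) ^ M.kindCard κ coloop)) := by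
    intro s t
    rw [← Finset.prod_add, prod_kind κ fun i => f s i + g t i]
    simp only [f, g]
    rw [add_comm v, add_comm s]
  have hterm : ∀ A ∈ E.powerset, (if (∃ q ∈ A, κ q = parallel) ∧ ∃ p ∈ M.E, κ p = path ∧ p ∉ A then
        u ^ (B \ A).card * v ^ (A \ B).card else 0)
      = (∏ e ∈ A, f v (κ e) - ∏ e ∈ A, f 0 (κ e)) *
        (∏ e ∈ E \ A, g u (κ e) - ∏ e ∈ E \ A, g 0 (κ e)) := by
    intro A hA
    have hAE := Finset.mem_powerset.1 hA
    by_cases hq : ∃ q ∈ A, κ q = parallel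
    · by_cases hp : ∃ p ∈ M.E, κ p = path ∧ p ∉ A
      · rw [if_pos ⟨hq, hp⟩]
        obtain ⟨q, hq, hκq⟩ := hq
        obtain ⟨p, hp, hκp, hpA⟩ := hp
        rw [Finset.prod_eq_zero (f := fun e => f 0 (κ e)) hq (by simp [f, hκq]),
          Finset.prod_eq_zero (f := fun e => g 0 (κ e))
            (Finset.mem_sdiff.2 ⟨(hEmem p).2 hp, hpA⟩) (by simp [g, hκp]), sub_zero, sub_zero,
          mul_comm]
        have h1 : ∏ e ∈ A, f v (κ e) = ∏ e ∈ A, if e ∈ B then 1 else v := by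
          refine Finset.prod_congr rfl fun e he => ?_
          have := (hEmem e).1 (hAE he)
          cases hκ : κ e <;> simp [f, hBmem, hκ, this]
        have h2 : ∏ e ∈ E \ A, g u (κ e) = ∏ e ∈ E \ A, if e ∈ B then u else 1 := by
          refine Finset.prod_congr rfl fun e he => ?_
          have := (hEmem e).1 (Finset.mem_sdiff.1 he).1
          cases hκ : κ e <;> simp [g, hBmem, hκ, this]
        rw [h1, h2, Finset.prod_ite, Finset.prod_ite]
        simp only [Finset.prod_const_one, one_mul, mul_one, Finset.prod_const]
        congr 3
        · ext x; simp
        · ext x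
          simp only [Finset.mem_sdiff, Finset.mem_filter, hEmem]
          exact ⟨fun h => ⟨⟨((hBmem x).1 h.1).1, h.2⟩, h.1⟩, fun h => ⟨h.2, h.1.2⟩⟩
      · rw [if_neg fun h => hp h.2]
        have : ∏ e ∈ E \ A, g u (κ e) = ∏ e ∈ E \ A, g 0 (κ e) := by
          refine Finset.prod_congr rfl fun e he => ?_
          rw [Finset.mem_sdiff, hEmem] at he
          cases hκ : κ e with
          | path => exact absurd ⟨e, he.1, hκ, he.2⟩ hp
          | _ => rfl
        rw [this, sub_self, mul_zero]
    · rw [if_neg fun h => hq h.1]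
      have : ∏ e ∈ A, f v (κ e) = ∏ e ∈ A, f 0 (κ e) := by
        refine Finset.prod_congr rfl fun e he => ?_
        cases hκ : κ e with
        | parallel => exact absurd ⟨e, he, hκ⟩ hq
        | _ => rfl
      rw [this, sub_self, zero_mul]
  rw [Finset.sum_congr rfl hterm]
  simp only [sub_mul, mul_sub, Finset.sum_sub_distrib, hfg]
  ring

/-- The Tutte polynomial of a minimal matroid with loops and coloops. -/
theorem IsColoring.mul_sub_tutte [M.Finite] {κ : α → ElementKind} (h : M.IsColoring κ) {n k : ℕ}
    (hn : M.E.ncard = n) (hk : M.eRank = k) :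
    (X 0 - 1) * (X 1 - 1) * (X 0 ^ k * X 1 ^ (n - k) - M.tutte) =
      ((X 0 - 1) * (X 1 - 1) - 1) * ((X 0 ^ k - X 0 ^ M.kindCard κ coloop) *
        (X 1 ^ (n - k) - X 1 ^ M.kindCard κ loop)) := by
  classical
  obtain ⟨B, hB⟩ := (M.ground_finite.subset (Set.sep_subset M.E fun e =>
    κ e = path ∨ κ e = coloop)).exists_finset_coe
  have hbase : M.IsBase B := hB ▸ h.isBase
  have hsum := sum_filter_parallel_path (M := M) κ (X 0 - 1 : MvPolynomial (Fin 2) ℤ) (X 1 - 1) hB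
  have hk' := h.kindCard_path_add_kindCard_coloop hk
  have hn' := sum_kindCard (M := M) κ
  rw [hn] at hn'
  have e1 : k = M.kindCard κ path + M.kindCard κ coloop := hk'.symm
  have e2 : n - k = M.kindCard κ loop + M.kindCard κ parallel := by omega
  have e3 : ((X 0 ^ k - X 0 ^ M.kindCard κ coloop) * (X 1 ^ (n - k) - X 1 ^ M.kindCard κ loop)
      : MvPolynomial (Fin 2) ℤ) = X 1 ^ M.kindCard κ loop * X 0 ^ M.kindCard κ coloop *
        ((X 0 ^ M.kindCard κ path - 1) * (X 1 ^ M.kindCard κ parallel - 1)) := by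
    rw [e2, e1]
    ring
  rw [e3]
  rw [add_sub_cancel, add_sub_cancel] at hsum
  rw [← hsum, pow_mul_pow_eq_sum hn hk hbase, tutte_eq_sum hk, ← Finset.sum_sub_distrib,
    Finset.mul_sum, Finset.mul_sum]
  refine Finset.sum_congr rfl fun A hA => ?_
  have hAE : (A : Set α) ⊆ M.E := fun x hx => by simpa using Finset.mem_powerset.1 hA hx
  have key := hbase.pow_mul_pow_mul_pow (X 0 - 1 : MvPolynomial (Fin 2) ℤ) (X 1 - 1) hk A
  have hr := h.toNat_eRk_eq hAE hB
  have hr' : (M.eRk A).toNat - (A ∩ B).card =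
    if (∃ q ∈ A, κ q = parallel) ∧ ∃ p ∈ M.E, κ p = path ∧ p ∉ A then 1 else 0 := by
    rw [hr, add_tsub_cancel_left]
  rw [hr'] at key
  rw [← key]
  split_ifs
  · ring
  · ring

end Matroid

/-! ### The Tutte polynomials of the classes are independent and span. -/

namespace Matroid

open ElementKind MvPolynomial

variable {α β : Type*}

theorem isIso_mapEquiv (M : Matroid α) (f : α ≃ β) : M.IsIso (M.mapEquiv f) := by
  refine ⟨f.image M.E, fun I => ?_⟩
  rw [mapEquiv_indep_iff]
  have : f.symm '' (Subtype.val '' (f.image M.E '' I)) = Subtype.val '' I := by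
    rw [← Set.image_comp, ← Set.image_comp]
    congr 1
    ext x
    simp
  exact iff_of_eq (congrArg M.Indep this.symm)

theorem mul_ne_zero_X_sub_one :
    ((X 0 - 1) * (X 1 - 1) : MvPolynomial (Fin 2) ℤ) ≠ 0 := by
  intro h
  have := congrArg (MvPolynomial.eval fun _ => (2 : ℤ)) h
  simp at this

theorem mul_sub_one_ne_zero_X_sub_one :
    ((X 0 - 1) * (X 1 - 1) - 1 : MvPolynomial (Fin 2) ℤ) ≠ 0 := by
  intro h
  have := congrArg (MvPolynomial.eval fun _ => (1 : ℤ)) h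
  simp at this

theorem coeff_X_pow_mul_X_pow (a b i j : ℕ) :
    coeff (Finsupp.single 0 i + Finsupp.single 1 j) (X 0 ^ a * X 1 ^ b : MvPolynomial (Fin 2) ℤ)
      = if a = i ∧ b = j then 1 else 0 := by
  rw [X_pow_eq_monomial, X_pow_eq_monomial, monomial_mul, one_mul, coeff_monomial]
  congr 1
  rw [eq_iff_iff]
  refine ⟨fun h => ?_, fun ⟨h1, h2⟩ => by rw [h1, h2]⟩
  have h0 := DFunLike.congr_fun h 0
  have h1 := DFunLike.congr_fun h 1
  simp at h0 h1
  exact ⟨h0, h1⟩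

/-- The other three terms have exponent `k` in x or `m` in y, out of reach of `i < k` and `j < m`.
-/
theorem coeff_sub_mul_sub {k m a b i j : ℕ} (hi : i < k) (hj : j < m) :
    coeff (Finsupp.single 0 i + Finsupp.single 1 j)
      ((X 0 ^ k - X 0 ^ a) * (X 1 ^ m - X 1 ^ b) : MvPolynomial (Fin 2) ℤ)
      = if a = i ∧ b = j then 1 else 0 := by
  simp only [sub_mul, mul_sub, coeff_sub, coeff_X_pow_mul_X_pow]
  rw [if_neg (by omega), if_neg (by omega), if_neg (by omega)]
  ring

theorem exists_graphicSchubertClass {n k l m : ℕ} (hkn : k ≤ n) (hl : l ≤ k) (hm : m ≤ n - k) :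
    ∃ q : GraphicSchubertClass n k,
      (X 0 - 1) * (X 1 - 1) * (X 0 ^ k * X 1 ^ (n - k) - q.tutte) =
        ((X 0 - 1) * (X 1 - 1) - 1) * ((X 0 ^ k - X 0 ^ l) * (X 1 ^ (n - k) - X 1 ^ m)) := by
  have hab : k - l ≤ n - m - l := by omega
  set N := minimalWithLoopsColoops m (k - l) (n - m - l) l hab with hN
  have hNc : N.IsColoring _ := isColoring_minimalWithLoopsColoops hab
  obtain ⟨c1, c2, c3, c4⟩ := kindCard_standardKind (m := m) (l := l) hab
  rw [← hN] at c1 c2 c3 c4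
  have hNE : N.E.ncard = n := by
    rw [hN, minimalWithLoopsColoops_ground, Set.ncard_univ]
    simp only [Nat.card_eq_fintype_card, Fintype.card_sum, Fintype.card_fin]
    omega
  have hNk : N.eRank = k := by
    have h1 := hNc.isBase.encard_eq_eRank
    have h2 : N.eRank = (N.eRank.toNat : ℕ) := by
      rw [← h1, ENat.natCast_toNat]
      exact (Set.toFinite _).encard_lt_top.ne
    have h3 := hNc.kindCard_path_add_kindCard_coloop h2
    rw [h2, ← h3, c2, c4]
    congr 1
    omega
  have hcard : Fintype.card (Fin m ⊕ (Fin (n - m - l) ⊕ Fin l)) = Fintype.card (Fin n) := by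
    simp only [Fintype.card_sum, Fintype.card_fin]
    omega
  set f := Fintype.equivOfCardEq hcard
  have hiso := isIso_mapEquiv N f
  obtain ⟨κ, hκ⟩ := hNc.of_isIso hiso.symm
  have hE : (N.mapEquiv f).E = Set.univ := by
    rw [mapEquiv_ground_eq, hN, minimalWithLoopsColoops_ground, Set.image_univ]
    exact f.surjective.range_eq
  have hrank : (N.mapEquiv f).eRank = k := by
    rw [mapEquiv_eq_map, eRank_map, hNk]
  refine ⟨Quotient.mk (graphicSchubertSetoid n k)
    ⟨N.mapEquiv f, hE, hrank, hκ.isGraphic, hκ.isSchubert⟩, ?_⟩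
  have key := hNc.mul_sub_tutte hNE hNk
  rw [c1, c4, hiso.tutte_eq] at key
  exact key

/-- Every class of graphic Schubert matroids is determined by its numbers of coloops and loops, in a
normalized presentation. -/
theorem exists_graphicSchubertClass_parameters {n k : ℕ} :
    ∃ (l m : GraphicSchubertClass n k → ℕ),
      (∀ q q', l q = l q' → m q = m q' → q = q') ∧
      (∀ q, (l q < k ∧ m q < n - k) ∨ (l q = k ∧ m q = n - k)) ∧
      ∀ q, (X 0 - 1) * (X 1 - 1) * (X 0 ^ k * X 1 ^ (n - k) - q.tutte) =
        ((X 0 - 1) * (X 1 - 1) - 1) * ((X 0 ^ k - X 0 ^ l q) * (X 1 ^ (n - k) - X 1 ^ m q)) := by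
  have hex : ∀ q : GraphicSchubertClass n k, ∃ N : GraphicSchubert n k, ∃ κ,
      Quotient.mk (graphicSchubertSetoid n k) N = q ∧ N.1.IsNormalColoring κ := by
    intro q
    induction q using Quotient.inductionOn with
    | h N =>
      obtain ⟨κ, hκ⟩ := N.2.2.2.1.exists_isNormalColoring N.2.2.2.2
      exact ⟨N, κ, rfl, hκ⟩
  choose N κ hq hκ using hex
  have hn : ∀ q, (N q).1.E.ncard = n := by
    intro q
    rw [(N q).2.1, Set.ncard_univ]
    simp
  have hk : ∀ q, (N q).1.eRank = k := fun q => (N q).2.2.1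
  have hsum := fun q => (sum_kindCard (M := (N q).1) (κ q)).trans (hn q)
  have hsum' := fun q => (hκ q).1.kindCard_path_add_kindCard_coloop (hk q)
  refine ⟨fun q => (N q).1.kindCard (κ q) coloop, fun q => (N q).1.kindCard (κ q) loop,
    fun q q' hl hm => ?_, fun q => ?_, fun q => ?_⟩
  · simp only at hl hm
    have h1 := hsum q
    have h2 := hsum q'
    have h3 := hsum' q
    have h4 := hsum' q'
    rw [← hq q, ← hq q']
    refine Quotient.sound ((hκ q).1.isIso (hκ q').1 ?_)
    rintro (_ | _ | _ | _)
    · exact hm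
    · omega
    · omega
    · exact hl
  · have h1 := hsum q
    have h3 := hsum' q
    have hpos : ∀ t, 0 < (N q).1.kindCard (κ q) t ↔ ∃ e ∈ (N q).1.E, κ q e = t := by
      intro t
      exact Set.ncard_pos
    have h5 := (hκ q).2
    -- Normality makes path and parallel elements vanish together. This merges all presentations of
    -- the matroid consisting of loops and coloops into the single pair (k, n - k).
    rw [← hpos, ← hpos] at h5
    simp only
    omega
  · have := (hκ q).1.mul_sub_tutte (hn q) (hk q)
    conv_lhs => rw [← hq q]
    exact this

theorem linearIndependent_tutte (n k : ℕ) :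
    LinearIndependent ℤ (GraphicSchubertClass.tutte : GraphicSchubertClass n k → _) := by
  classical
  obtain ⟨l, m, hinj, hnorm, hT⟩ := exists_graphicSchubertClass_parameters (n := n) (k := k)
  rw [linearIndependent_iff']
  intro s c hc
  -- At x = y = 2 the factor (x - 1)(y - 1) - 1 vanishes, leaving the same nonzero value for every
  -- class.
  have heval : ∀ q : GraphicSchubertClass n k,
      MvPolynomial.eval (fun _ => (2 : ℤ)) q.tutte = 2 ^ k * 2 ^ (n - k) := by
    intro q
    have := congrArg (MvPolynomial.eval fun _ => (2 : ℤ)) (hT q)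
    simp at this
    linarith
  have hcsum : ∑ q ∈ s, c q = 0 := by
    have := congrArg (MvPolynomial.eval fun _ => (2 : ℤ)) hc
    simp only [map_sum, map_zsmul, heval, smul_eq_mul, map_zero] at this
    rw [← Finset.sum_mul] at this
    exact (mul_eq_zero.1 this).resolve_right (by positivity)
  have hzero : ∑ q ∈ s, c q • (((X 0 ^ k - X 0 ^ l q) * (X 1 ^ (n - k) - X 1 ^ m q)) :
      MvPolynomial (Fin 2) ℤ) = 0 := by
    refine (mul_eq_zero.1 ?_).resolve_left mul_sub_one_ne_zero_X_sub_one
    rw [Finset.mul_sum]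
    simp_rw [mul_smul_comm, ← hT, ← mul_smul_comm, ← Finset.mul_sum, smul_sub,
      Finset.sum_sub_distrib, hc, ← Finset.sum_smul, hcsum, zero_smul, sub_zero, mul_zero]
  have hsmall : ∀ q ∈ s, l q < k ∧ m q < n - k → c q = 0 := by
    intro q hq ⟨h1, h2⟩
    have := congrArg (coeff (Finsupp.single 0 (l q) + Finsupp.single 1 (m q))) hzero
    simp only [coeff_sum, coeff_smul, coeff_sub_mul_sub h1 h2, coeff_zero] at this
    rw [Finset.sum_eq_single_of_mem q hq fun q' _ hne => by
      rw [if_neg fun hh => hne (hinj q' q hh.1 hh.2), smul_zero]] at this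
    simpa using this
  intro q hq
  -- The pair (k, n - k) contributes a zero product, so its coefficient comes from the vanishing of
  -- the coefficient sum.
  rcases hnorm q with h | h
  · exact hsmall q hq h
  · rw [Finset.sum_eq_single_of_mem q hq fun q' hq' hne => hsmall q' hq'
      ((hnorm q').resolve_right fun h' => hne (hinj q' q (h'.1.trans h.1.symm)
        (h'.2.trans h.2.symm)))] at hcsum
    exact hcsum

/-- The binomial expansion involves only smaller exponents, and the box of exponents is closed
downwards. -/
theorem sub_one_pow_mul_sub_one_pow_mem {R : Type*} [CommRing R] (S : Submodule ℤ R) (c x y : R)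
    {k m : ℕ} (hS : ∀ i < k, ∀ j < m, c * (x ^ i * y ^ j) ∈ S) {i j : ℕ} (hi : i < k)
    (hj : j < m) : c * ((x - 1) ^ i * (y - 1) ^ j) ∈ S := by
  rw [sub_eq_add_neg, sub_eq_add_neg, add_pow, add_pow, Finset.sum_mul_sum, Finset.mul_sum]
  refine S.sum_mem fun a ha => ?_
  rw [Finset.mul_sum]
  refine S.sum_mem fun b hb => ?_
  have ha' := Finset.mem_range.1 ha
  have hb' := Finset.mem_range.1 hb
  have := S.smul_mem ((-1) ^ (i - a) * (i.choose a : ℤ) * ((-1) ^ (j - b) * (j.choose b : ℤ)))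
    (hS a (by omega) b (by omega))
  convert this using 1
  rw [zsmul_eq_mul]
  push_cast
  ring

theorem tutte_mem_span (M : Matroid α) [M.Finite] {n k : ℕ} (hn : M.E.ncard = n)
    (hk : M.eRank = k) :
    M.tutte ∈ Submodule.span ℤ
      (Set.range (GraphicSchubertClass.tutte : GraphicSchubertClass n k → _)) := by
  set S := Submodule.span ℤ
    (Set.range (GraphicSchubertClass.tutte : GraphicSchubertClass n k → _)) with hS
  have hkn : k ≤ n := by
    have := M.eRank_le_encard_ground
    rw [hk, ← M.ground_finite.cast_ncard_eq, hn] at this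
    exact_mod_cast this
  have hX : (X 0 ^ k * X 1 ^ (n - k) : MvPolynomial (Fin 2) ℤ) ∈ S := by
    -- With l = k and m = n - k the right side is zero: the class of loops and coloops has Tutte
    -- polynomial x^k y^(n-k).
    obtain ⟨q, hq⟩ := exists_graphicSchubertClass hkn le_rfl (le_refl (n - k))
    rw [sub_self, zero_mul, mul_zero] at hq
    rw [sub_eq_zero.1 ((mul_eq_zero.1 hq).resolve_left mul_ne_zero_X_sub_one)]
    exact Submodule.subset_span ⟨q, rfl⟩
  have hD : ∀ l ≤ k, ∀ m ≤ n - k, ∃ D ∈ S, (X 0 - 1) * (X 1 - 1) * D =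
      ((X 0 - 1) * (X 1 - 1) - 1) * ((X 0 ^ k - X 0 ^ l) * (X 1 ^ (n - k) - X 1 ^ m)) := by
    intro l hl m hm
    obtain ⟨q, hq⟩ := exists_graphicSchubertClass hkn hl hm
    exact ⟨_, S.sub_mem hX (Submodule.subset_span ⟨q, rfl⟩), hq⟩
  have hmon : ∀ i < k, ∀ j < n - k, ((X 0 - 1) * (X 1 - 1) - 1) * (X 0 ^ i * X 1 ^ j) ∈ S := by
    intro i hi j hj
    -- Mixed second difference: (x^(i+1) - x^i)(y^(j+1) - y^j) = (x - 1)(y - 1) x^i y^j, and the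
    -- common factor (x - 1)(y - 1) cancels.
    obtain ⟨D₁, h₁, e₁⟩ := hD i hi.le j hj.le
    obtain ⟨D₂, h₂, e₂⟩ := hD (i + 1) hi j hj.le
    obtain ⟨D₃, h₃, e₃⟩ := hD i hi.le (j + 1) hj
    obtain ⟨D₄, h₄, e₄⟩ := hD (i + 1) hi (j + 1) hj
    have : ((X 0 - 1) * (X 1 - 1) - 1) * (X 0 ^ i * X 1 ^ j) = D₁ - D₂ - D₃ + D₄ := by
      refine mul_left_cancel₀ mul_ne_zero_X_sub_one ?_
      linear_combination -e₁ + e₂ + e₃ - e₄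
    rw [this]
    exact S.add_mem (S.sub_mem (S.sub_mem h₁ h₂) h₃) h₄
  have hdiff := sub_tutte_mem hn hk S fun i hi j hj =>
    sub_one_pow_mul_sub_one_pow_mem S _ _ _ hmon hi hj
  simpa using S.sub_mem hX hdiff

end Matroid

theorem theoremE {α : Type*} (M : Matroid α) [M.Finite] (n k : ℕ)
    (hn : M.E.ncard = n) (hk : M.eRank = k) :
    (∃! c : Matroid.GraphicSchubertClass n k →₀ ℤ,
      M.tutte = c.sum fun N a => a • N.tutte) ∧
    (M.IsGraphic ∧ M.IsSchubert ↔
      ∃ (m l a b : ℕ) (h : a ≤ b), a + l = k ∧ m + b + l = n ∧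
        M.IsIso (Matroid.minimalWithLoopsColoops m a b l h)) := by
  refine ⟨?_, M.isGraphic_and_isSchubert_iff hn hk⟩
  obtain ⟨c, hc⟩ := Finsupp.mem_span_range_iff_exists_finsupp.1 (M.tutte_mem_span hn hk)
  refine ⟨c, hc.symm, fun c' hc' => ?_⟩
  have hinj : Function.Injective (Finsupp.linearCombination ℤ
    (Matroid.GraphicSchubertClass.tutte : Matroid.GraphicSchubertClass n k → _)) :=
    Matroid.linearIndependent_tutte n k
  refine hinj ?_
  rw [Finsupp.linearCombination_apply, Finsupp.linearCombination_apply]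
  exact hc'.symm.trans hc.symm
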